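/- **Theorem 4.1 (first variation formula).** Let $M$ be a smooth manifold of dimension $m\ge 0$ (Hausdorff, second countable, without boundary), let $p\ge 0$, let $\xi:M\to\mathbb R^{m+p}$ be a smooth map, and let $x:M\to\mathbb R^{m+p}$ be a smooth immersion. For an immersion $y:M\to\mathbb R^{m+p}$ let $dV_y$ be the volume measure of the induced metric $g_y=y^*\langle\cdot,\cdot\rangle$, let $v^{\perp}$ be the component of $v$ normal to $y$, let $H_y=\operatorname{tr}_{g_y}h_y=g_y^{ij}\big(\tfrac{\partial^2 y}{\partial u^i\partial u^j}\big)^{\perp}$ be the mean curvature vector, and let $\nabla^y\varphi$ be the gradient of $\varphi:M\to\mathbb R$ with respect to $g_y$, regarded as the vector $g_y^{ij}\tfrac{\partial\varphi}{\partial u^j}\tfrac{\partial y}{\partial u^i}$ of $\mathbb R^{m+p}$. Put $$f_y=\tfrac12|y-\xi|^2,\qquad \bar f_y=f_y-\tfrac12|\xi|^2,$$ $$V_\xi(y;D)=\int_D e^{-f_y}\,dV_y,\qquad \bar V_\xi(y;D)=\int_D e^{-\bar f_y}\,dV_y\qquad (D\subseteq M \text{ Borel}),$$ and $V_\xi(y)=V_\xi(y;M)$,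 $\bar V_\xi(y)=\bar V_\xi(y;M)$. Let $\varepsilon>0$ and let $F:M\times(-\varepsilon,\varepsilon)\to\mathbb R^{m+p}$ be a compact variation of $x$: $F$ is smooth, $F(\cdot,0)=x$, every $x_t=F(\cdot,t)$ is an immersion, and there is a relatively compact open set $B\subseteq M$ that contains, for every $t\in(-\varepsilon,\varepsilon)$, the closure of $\{q\in M: \tfrac{\partial F}{\partial t}(q,t)\ne 0\}$. Write $H_t=H_{x_t}$, $\nabla^t=\nabla^{x_t}$, $dV_t=dV_{x_t}$, $f_t=f_{x_t}$, $\bar f_t=\bar f_{x_t}$, $H=H_0$, $f=f_0$, $\bar f=\bar f_0$, $dV=dV_0$, and $\eta=\tfrac{\partial F}{\partial t}\big|_{t=0}$. Let $D\subseteq M$ be a Borel set with $B\subseteq D$ (for instance $D=M$). (1) If $V_\xi(x;D)<\infty$, then for every $t\in(-\varepsilon,\varepsilon)$ one has $V_\xi(x_t;D)<\infty$, the function $s\mapsto V_\xi(x_s;D)$ is differentiable at $t$, the integrand below is integrable, and $$\frac{d}{dt}V_\xi(x_t;D)=-\int_M\Big\langle (H_t+x_t^{\perp}-\xi)+\nabla^t\big(\langle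 x_t,\xi\rangle-\tfrac12|\xi|^2\big),\ \frac{\partial F}{\partial t}\Big\rangle e^{-f_t}\,dV_t .$$ If moreover $F$ is a normal variation, that is, $\eta$ is everywhere normal to $x$, then $$\frac{d}{dt}\Big|_{t=0}V_\xi(x_t;D)=-\int_M\langle H+x^{\perp}-\xi,\ \eta\rangle e^{-f}\,dV,$$ where the integrand is integrable. (2) If $\bar V_\xi(x;D)<\infty$, then for every $t\in(-\varepsilon,\varepsilon)$ one has $\bar V_\xi(x_t;D)<\infty$, the function $s\mapsto \bar V_\xi(x_s;D)$ is differentiable at $t$, the integrand below is integrable, and $$\frac{d}{dt}\bar V_\xi(x_t;D)=-\int_M\Big\langle (H_t+x_t^{\perp}-\xi)+\nabla^t\langle x_t,\xi\rangle,\ \frac{\partial F}{\partial t}\Big\rangle e^{-\bar f_t}\,dV_t .$$ If moreover $F$ is a normal variation, then $$\frac{d}{dt}\Big|_{t=0}\bar V_\xi(x_t;D)=-\int_M\langle H+x^{\perp}-\xi,\ \eta\rangle e^{-\bar f}\,dV,$$ where the integrand is integrable. For $D=M$ these are the formulas for the functionals $V_\xi$ and $\bar V_\xi$. For a relatively compact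 $D\supseteq B$, such as $D=\overline B$, the finiteness assumptions hold automatically. -/

import Mathlib

open Set MeasureTheory
open scoped Manifold ContDiff InnerProductSpace

noncomputable section

namespace FirstVariation

variable {n : ℕ} {M : Type*} [TopologicalSpace M]

/-- A smooth immersion `x : M → ℝⁿ`: a smooth map whose differential is injective everywhere. -/
structure IsImmersedSubmanifold (m : ℕ) [ChartedSpace (EuclideanSpace ℝ (Fin m)) M]
    (x : M → EuclideanSpace ℝ (Fin n)) : Prop where
  smooth : ContMDiff (𝓡 m) (𝓡 n) ∞ x
  injective_mfderiv : ∀ q : M, Function.Injective (mfderiv (𝓡 m) (𝓡 n) x q)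

/-! ### Local coordinates

`u = (u¹, …, uᵐ)` are the coordinates of the preferred chart `chartAt _ q` around `q`. -/

/-- The partial derivative `∂φ/∂uⁱ`, in the chart around `q`, at the coordinate point `u`. -/
def coordDeriv {m : ℕ} [ChartedSpace (EuclideanSpace ℝ (Fin m)) M]
    {W : Type*} [NormedAddCommGroup W] [NormedSpace ℝ W]
    (φ : M → W) (q : M) (i : Fin m) (u : EuclideanSpace ℝ (Fin m)) : W :=
  fderiv ℝ (fun v => φ ((chartAt (EuclideanSpace ℝ (Fin m)) q).symm v)) u
    (EuclideanSpace.single i 1)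

/-- The second partial derivative `∂²φ/∂uʲ∂uⁱ`, in the chart around `q`, at `u`. -/
def coordDeriv₂ {m : ℕ} [ChartedSpace (EuclideanSpace ℝ (Fin m)) M]
    {W : Type*} [NormedAddCommGroup W] [NormedSpace ℝ W]
    (φ : M → W) (q : M) (i j : Fin m) (u : EuclideanSpace ℝ (Fin m)) : W :=
  fderiv ℝ (coordDeriv φ q i) u (EuclideanSpace.single j 1)

/-- The coordinates of `q` in the chart around `q`. -/
def coordPt (m : ℕ) [ChartedSpace (EuclideanSpace ℝ (Fin m)) M]
    (q : M) : EuclideanSpace ℝ (Fin m) :=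
  chartAt (EuclideanSpace ℝ (Fin m)) q q

/-- The matrix `g_{ij} = ⟨∂x/∂uⁱ, ∂x/∂uʲ⟩` of the induced metric of `x`, in the chart around `q`,
at the coordinate point `u`. -/
def metricMatrix {m : ℕ} [ChartedSpace (EuclideanSpace ℝ (Fin m)) M]
    (x : M → EuclideanSpace ℝ (Fin n)) (q : M) (u : EuclideanSpace ℝ (Fin m)) :
    Matrix (Fin m) (Fin m) ℝ :=
  Matrix.of fun i j => ⟪coordDeriv x q i u, coordDeriv x q j u⟫_ℝ

/-! ### Tangent and normal spaces, mean curvature vector, gradient -/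

/-- The tangent space `x_*(T_q M)`, as a subspace of `ℝⁿ`. -/
def tangentPlane (m : ℕ) [ChartedSpace (EuclideanSpace ℝ (Fin m)) M]
    (x : M → EuclideanSpace ℝ (Fin n)) (q : M) :
    Submodule ℝ (EuclideanSpace ℝ (Fin n)) :=
  LinearMap.range (mfderiv (𝓡 m) (𝓡 n) x q).toLinearMap

/-- The component `v^⊥` of a vector `v` of `ℝⁿ` that is normal to `x` at `q`. -/
def normalPart (m : ℕ) [ChartedSpace (EuclideanSpace ℝ (Fin m)) M]
    (x : M → EuclideanSpace ℝ (Fin n)) (q : M) (v : EuclideanSpace ℝ (Fin n)) :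
    EuclideanSpace ℝ (Fin n) :=
  (tangentPlane m x q)ᗮ.starProjection v

/-- The components `h_{ij} = (∂²x/∂uʲ∂uⁱ)^⊥` at `q` of the second fundamental form of `x`. -/
def secondFundamentalForm {m : ℕ} [ChartedSpace (EuclideanSpace ℝ (Fin m)) M]
    (x : M → EuclideanSpace ℝ (Fin n)) (q : M) (i j : Fin m) :
    EuclideanSpace ℝ (Fin n) :=
  normalPart m x q (coordDeriv₂ x q i j (coordPt m q))

/-- The mean curvature vector `H = tr_g h = g^{ij} h_{ij}` of `x` at `q`. -/
def meanCurvature (m : ℕ) [ChartedSpace (EuclideanSpace ℝ (Fin m)) M]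
    (x : M → EuclideanSpace ℝ (Fin n)) (q : M) : EuclideanSpace ℝ (Fin n) :=
  ∑ i : Fin m, ∑ j : Fin m,
    (metricMatrix x q (coordPt m q))⁻¹ i j • secondFundamentalForm x q i j

/-- The gradient `∇φ` at `q` with respect to the induced metric of `x`, regarded as the vector
`g^{ij} (∂φ/∂uʲ) ∂x/∂uⁱ` of `x_*(T_q M) ⊆ ℝⁿ`. -/
def inducedGradient (m : ℕ) [ChartedSpace (EuclideanSpace ℝ (Fin m)) M]
    (x : M → EuclideanSpace ℝ (Fin n)) (φ : M → ℝ) (q : M) :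
    EuclideanSpace ℝ (Fin n) :=
  ∑ i : Fin m, ∑ j : Fin m,
    ((metricMatrix x q (coordPt m q))⁻¹ i j * coordDeriv φ q j (coordPt m q)) •
      coordDeriv x q i (coordPt m q)

/-! ### The volume measure of the induced metric -/

/-- The volume measure `√(det g_{ij}) du` of the induced metric of `x` on the domain of the chart
around `q`, as a measure on `M` that is zero outside of this domain. -/
def chartVolume (m : ℕ) [ChartedSpace (EuclideanSpace ℝ (Fin m)) M]
    [MeasurableSpace M] (x : M → EuclideanSpace ℝ (Fin n)) (q : M) : Measure M :=
  Measure.map (chartAt (EuclideanSpace ℝ (Fin m)) q).symm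
    ((volume.restrict (chartAt (EuclideanSpace ℝ (Fin m)) q).target).withDensity
      fun u => ENNReal.ofReal (Real.sqrt (metricMatrix x q u).det))

/-- The volume measure `dV_x` of the induced metric of `x`. The measures `√(det g_{ij}) du` of two
charts agree on the overlap of the domains, so `dV_x`, the measure on `M` that restricts to
`√(det g_{ij}) du` on the domain of every chart, is their least upper bound. -/
def inducedVolume (m : ℕ) [ChartedSpace (EuclideanSpace ℝ (Fin m)) M]
    [MeasurableSpace M] (x : M → EuclideanSpace ℝ (Fin n)) : Measure M :=
  ⨆ q : M, chartVolume m x q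

/-- The map used to push forward in `chartVolume` is a.e. measurable, so that `chartVolume` is
given by the expected formula. -/
theorem chartVolume_apply {m : ℕ} [ChartedSpace (EuclideanSpace ℝ (Fin m)) M]
    [MeasurableSpace M] [BorelSpace M] (x : M → EuclideanSpace ℝ (Fin n))
    (q : M) {A : Set M} (hA : MeasurableSet A) :
    chartVolume m x q A =
      ∫⁻ u in (chartAt (EuclideanSpace ℝ (Fin m)) q).target ∩
          (chartAt (EuclideanSpace ℝ (Fin m)) q).symm ⁻¹' A,
        ENNReal.ofReal (Real.sqrt (metricMatrix x q u).det) := by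
  set c := chartAt (EuclideanSpace ℝ (Fin m)) q with hc
  have hm : AEMeasurable c.symm (volume.restrict c.target) :=
    c.continuousOn_symm.aemeasurable c.open_target.measurableSet
  have hm' : NullMeasurableSet (c.symm ⁻¹' A) (volume.restrict c.target) :=
    hm.nullMeasurable hA
  rw [chartVolume, ← hc, Measure.map_apply_of_aemeasurable
    (hm.mono_ac (withDensity_absolutelyContinuous _ _)) hA,
    withDensity_apply₀ _ hm', Measure.restrict_restrict₀ hm', Set.inter_comm]

/-! ### The weighted volume functionals -/

/-- The function `f_x = |x - ξ|² / 2`. -/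
def weight (ξ x : M → EuclideanSpace ℝ (Fin n)) (q : M) : ℝ :=
  1 / 2 * ‖x q - ξ q‖ ^ 2

/-- The function `f̄_x = f_x - |ξ|² / 2`. -/
def weightBar (ξ x : M → EuclideanSpace ℝ (Fin n)) (q : M) : ℝ :=
  weight ξ x q - 1 / 2 * ‖ξ q‖ ^ 2

/-- The part `∫_D e^{-f_x} dV_x` of the functional `V_ξ` over `D ⊆ M`;
`V_ξ(x)` itself is the case `D = M`. -/
def volumeXi (m : ℕ) [ChartedSpace (EuclideanSpace ℝ (Fin m)) M]
    [MeasurableSpace M] (ξ x : M → EuclideanSpace ℝ (Fin n)) (D : Set M) : ℝ :=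
  ∫ q in D, Real.exp (-weight ξ x q) ∂(inducedVolume m x)

/-- The part `∫_D e^{-f̄_x} dV_x` of the functional `V̄_ξ` over `D ⊆ M`;
`V̄_ξ(x)` itself is the case `D = M`. -/
def volumeXiBar (m : ℕ) [ChartedSpace (EuclideanSpace ℝ (Fin m)) M]
    [MeasurableSpace M] (ξ x : M → EuclideanSpace ℝ (Fin n)) (D : Set M) : ℝ :=
  ∫ q in D, Real.exp (-weightBar ξ x q) ∂(inducedVolume m x)

/-! ### Variations

A variation is written `F t q`, so that `F t` is the immersion `x_t`. Only times `|t| < ε`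
matter. -/

/-- The vector field `∂F/∂t` along `x_t`. -/
def velocity (F : ℝ → M → EuclideanSpace ℝ (Fin n)) (t : ℝ) (q : M) : EuclideanSpace ℝ (Fin n) :=
  deriv (fun s => F s q) t

/-- `F : M × (-ε, ε) → ℝⁿ` is a (smooth) variation of `x` through immersions. -/
structure IsVariation (m : ℕ) [ChartedSpace (EuclideanSpace ℝ (Fin m)) M]
    (x : M → EuclideanSpace ℝ (Fin n)) (ε : ℝ)
    (F : ℝ → M → EuclideanSpace ℝ (Fin n)) : Prop where
  smooth : ContMDiffOn ((𝓡 m).prod 𝓘(ℝ, ℝ)) (𝓡 n) ∞ (fun z : M × ℝ => F z.2 z.1)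
    (univ ×ˢ Ioo (-ε) ε)
  initial : F 0 = x
  immersion : ∀ t ∈ Ioo (-ε) ε, IsImmersedSubmanifold m (F t)

/-- The variation `F` is compact: `B` is open and relatively compact, and the support of `∂F/∂t` is
contained in `B` at all times. -/
structure IsCompactVariation (ε : ℝ) (F : ℝ → M → EuclideanSpace ℝ (Fin n)) (B : Set M) :
    Prop where
  isOpen : IsOpen B
  isCompact_closure : IsCompact (closure B)
  support_subset : ∀ t ∈ Ioo (-ε) ε, closure {q : M | velocity F t q ≠ 0} ⊆ B

/-- The variation `F` of `x` is normal: the variation vector field `η = ∂F/∂t|_{t = 0}` is normal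
to `x`. -/
def IsNormalVariation (m : ℕ) [ChartedSpace (EuclideanSpace ℝ (Fin m)) M]
    (x : M → EuclideanSpace ℝ (Fin n))
    (F : ℝ → M → EuclideanSpace ℝ (Fin n)) : Prop :=
  ∀ q : M, velocity F 0 q ∈ (tangentPlane m x q)ᗮ

/-! ### The integrands of the first variation formulas -/

/-- The function `⟨(H + x^⊥ - ξ) + ∇(⟨x, ξ⟩ - |ξ|² / 2), v⟩ e^{-f_x}`. -/
def firstVarIntegrand (m : ℕ) [ChartedSpace (EuclideanSpace ℝ (Fin m)) M]
    (ξ x v : M → EuclideanSpace ℝ (Fin n)) (q : M) : ℝ :=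
  ⟪(meanCurvature m x q + normalPart m x q (x q) - ξ q)
      + inducedGradient m x (fun r => ⟪x r, ξ r⟫_ℝ - 1 / 2 * ‖ξ r‖ ^ 2) q, v q⟫_ℝ
    * Real.exp (-weight ξ x q)

/-- The function `⟨(H + x^⊥ - ξ) + ∇⟨x, ξ⟩, v⟩ e^{-f̄_x}`. -/
def firstVarIntegrandBar (m : ℕ) [ChartedSpace (EuclideanSpace ℝ (Fin m)) M]
    (ξ x v : M → EuclideanSpace ℝ (Fin n)) (q : M) : ℝ :=
  ⟪(meanCurvature m x q + normalPart m x q (x q) - ξ q)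
      + inducedGradient m x (fun r => ⟪x r, ξ r⟫_ℝ) q, v q⟫_ℝ
    * Real.exp (-weightBar ξ x q)

/-- The function `⟨H + x^⊥ - ξ, v⟩ e^{-f_x}`. -/
def normalVarIntegrand (m : ℕ) [ChartedSpace (EuclideanSpace ℝ (Fin m)) M]
    (ξ x v : M → EuclideanSpace ℝ (Fin n)) (q : M) : ℝ :=
  ⟪meanCurvature m x q + normalPart m x q (x q) - ξ q, v q⟫_ℝ * Real.exp (-weight ξ x q)

/-- The function `⟨H + x^⊥ - ξ, v⟩ e^{-f̄_x}`. -/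
def normalVarIntegrandBar (m : ℕ) [ChartedSpace (EuclideanSpace ℝ (Fin m)) M]
    (ξ x v : M → EuclideanSpace ℝ (Fin n)) (q : M) : ℝ :=
  ⟪meanCurvature m x q + normalPart m x q (x q) - ξ q, v q⟫_ℝ * Real.exp (-weightBar ξ x q)

end FirstVariation

end

open FirstVariation

open scoped Topology

noncomputable section

namespace FirstVariation

/-! ### Determinants and traces of matrices depending on a parameter -/

section Matrices

variable {ι Z : Type*} [Fintype ι] [DecidableEq ι] [NormedAddCommGroup Z] [NormedSpace ℝ Z]

/-! Both functionals have the form `∫_D e^{-φ} dV` with `φ = |x|²/2 - ⟨x, ξ⟩ + κ`, where `κ =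
|ξ|²/2` for the first and `κ = 0` for the second. One formula for an arbitrary smooth `κ`
(`IsVariation.first_variation`) therefore gives both.

Fix a time `t`. The measures `dV_s` are absolutely continuous with respect to `dV_t`, with a
continuous density `volRatio` (`inducedVolume_withDensity`). So the functional at time `s` is an
integral over the fixed measure `dV_t`. By Jacobi's formula and the symmetry of second derivatives,
`∂ₛ dV_s = (div v) dV_s`, where `v = ∂F/∂s` and `div v = g^{ij} ⟨∂ᵢv, ∂ⱼx⟩`; moreover `∂ₛ φ = ⟨x -
ξ, v⟩`. Thus the integrand has derivative `(div v - ⟨x - ξ, v⟩) e^{-φ}` times the density. This is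
jointly continuous and vanishes off `B`, so it is bounded by a constant on the compact closure of
`B` for times near `t`, and dominated convergence permits differentiation under the integral.

It remains to rewrite the integrand. Split `v = v^⊤ + v^⊥`. Differentiating `⟨v^⊥, ∂ⱼx⟩ = 0` gives
`div v^⊥ = -⟨H, v⟩`, and `∇φ = x^⊤ - ∇(⟨x, ξ⟩ - κ)`. Hence the claimed integrand equals `div(e^{-φ}
v^⊤)` minus the derivative of the density (`variationIntegrand_eq`). The field `e^{-φ} v^⊤` is
tangent with compact support, so its divergence integrates to zero (`integral_divergence_eq_zero`).
For a normal variation the gradient term is orthogonal to `η` and drops out.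

Two points need gluing over charts. The supremum of the chart measures must restrict to each chart
measure, which follows from change of variables. The divergence theorem is reduced by a partition of
unity to a single chart, where `√(det g) div V = ∑ₖ ∂ₖ(√(det g) aᵏ)`. -/

theorem contDiffAt_det {k : WithTop ℕ∞} {G : Z → Matrix ι ι ℝ} {z : Z}
    (hG : ∀ i j, ContDiffAt ℝ k (fun y => G y i j) z) :
    ContDiffAt ℝ k (fun y => (G y).det) z := by
  simp only [Matrix.det_apply']
  exact ContDiffAt.sum fun σ _ => contDiffAt_const.mul (contDiffAt_prod fun i _ => hG _ _)

theorem contDiffAt_inv_apply {k : WithTop ℕ∞} {G : Z → Matrix ι ι ℝ} {z : Z}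
    (hG : ∀ i j, ContDiffAt ℝ k (fun y => G y i j) z) (hdet : (G z).det ≠ 0) (i j : ι) :
    ContDiffAt ℝ k (fun y => (G y)⁻¹ i j) z := by
  simp only [Matrix.inv_def, Matrix.smul_apply, Ring.inverse_eq_inv', Matrix.adjugate_apply,
    smul_eq_mul]
  refine ((contDiffAt_det hG).inv hdet).mul (contDiffAt_det fun a b => ?_)
  simp only [Matrix.updateRow_apply]
  split_ifs
  · exact contDiffAt_const
  · exact hG _ _

/-- Factoring out `G` leaves `det(1 + r G⁻¹G')`, which is `1 + r tr(G⁻¹G')` plus `r²` times a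
polynomial in `r`. -/
theorem hasDerivAt_det_add_smul {G G' : Matrix ι ι ℝ} (hdet : G.det ≠ 0) :
    HasDerivAt (fun r : ℝ => (G + r • G').det) (G.det * (G⁻¹ * G').trace) 0 := by
  have key : ∀ r : ℝ, (G + r • G').det = G.det * (1 + r • (G⁻¹ * G')).det := fun r => by
    rw [← Matrix.det_mul, mul_add, mul_one, Matrix.mul_smul, ← mul_assoc,
      Matrix.mul_nonsing_inv _ (isUnit_iff_ne_zero.mpr hdet), one_mul]
  have key' := fun r : ℝ => (key r).trans (congrArg _ (Matrix.det_one_add_smul r (G⁻¹ * G')))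
  rw [funext key']
  refine HasDerivAt.const_mul _ ?_
  have h := (((hasDerivAt_id (0 : ℝ)).const_mul (G⁻¹ * G').trace).const_add 1).add
    (((Polynomial.hasDerivAt
      (((1 + (Polynomial.X : Polynomial ℝ) • (G⁻¹ * G').map Polynomial.C).det).divX.divX)
      (0 : ℝ))).mul
      ((hasDerivAt_id (0 : ℝ)).pow 2))
  convert! h using 1
  simp

/-- **Jacobi's formula** for the derivative of a determinant. -/
theorem hasDerivAt_det {G : ℝ → Matrix ι ι ℝ} {G' : Matrix ι ι ℝ} {t : ℝ}
    (hG : ∀ i j, HasDerivAt (fun s => G s i j) (G' i j) t) (hdet : (G t).det ≠ 0) :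
    HasDerivAt (fun s => (G s).det) ((G t).det * ((G t)⁻¹ * G').trace) t := by
  -- As a smooth function of the entries, the determinant has a derivative along a path that depends
  -- only on the velocity. The path may therefore be replaced by the straight line `G t + r • G'`.
  let d : (ι → ι → ℝ) → ℝ := fun A => Matrix.det (Matrix.of A)
  have hd : ∀ A, DifferentiableAt ℝ d A := fun A => by
    refine (contDiffAt_det (k := 1) fun i j => ?_).differentiableAt one_ne_zero
    exact (contDiff_apply_apply ℝ ℝ i j).contDiffAt
  have hpath : HasDerivAt (fun s => (fun i j => G s i j : ι → ι → ℝ)) (fun i j => G' i j) t :=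
    hasDerivAt_pi.mpr fun i => hasDerivAt_pi.mpr fun j => hG i j
  have h1 := (hd (fun i j => G t i j)).hasFDerivAt.comp_hasDerivAt t hpath
  have hline : HasDerivAt (fun r : ℝ => (fun i j => (G t + r • G') i j : ι → ι → ℝ))
      (fun i j => G' i j) 0 :=
    hasDerivAt_pi.mpr fun i => hasDerivAt_pi.mpr fun j => by
      simpa using ((hasDerivAt_id (0 : ℝ)).mul_const (G' i j)).const_add (G t i j)
  have h2 := HasFDerivAt.comp_hasDerivAt (f := fun r : ℝ => (fun i j => (G t + r • G') i j))
    (l := d) 0 (by simpa using (hd (fun i j => G t i j)).hasFDerivAt) hline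
  have h3 := h2.unique (hasDerivAt_det_add_smul hdet)
  exact h3 ▸ h1

theorem hasDerivAt_sqrt_det {G : ℝ → Matrix ι ι ℝ} {G' : Matrix ι ι ℝ} {t : ℝ}
    (hG : ∀ i j, HasDerivAt (fun s => G s i j) (G' i j) t) (hdet : 0 < (G t).det) :
    HasDerivAt (fun s => √(G s).det) (√(G t).det * (((G t)⁻¹ * G').trace / 2)) t := by
  convert! (hasDerivAt_det hG hdet.ne').sqrt hdet.ne' using 1
  have h : √(G t).det ≠ 0 := (Real.sqrt_pos.mpr hdet).ne'
  field_simp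
  rw [Real.sq_sqrt hdet.le, mul_comm]

/-- The trace of a bilinear form with respect to an inner product does not depend on the basis. -/
theorem sum_inv_congr (g P b : Matrix ι ι ℝ) (hP : IsUnit P.det) :
    ∑ i, ∑ j, (P.transpose * g * P)⁻¹ i j * (P.transpose * b * P) i j =
      ∑ i, ∑ j, g⁻¹ i j * b i j := by
  -- Written as a trace, the left side is `tr(P⁻¹ g⁻¹ bᵀ P)`, and cyclicity removes `P`.
  have key : ∀ A B : Matrix ι ι ℝ, ∑ i, ∑ j, A i j * B i j = (A * B.transpose).trace := by
    intro A B
    simp [Matrix.trace, Matrix.mul_apply]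
  have hPt : IsUnit P.transpose.det := by rwa [Matrix.det_transpose]
  rw [key, key, Matrix.mul_inv_rev, Matrix.mul_inv_rev, Matrix.transpose_mul, Matrix.transpose_mul,
    Matrix.transpose_transpose,
    show P⁻¹ * (g⁻¹ * P.transpose⁻¹) * (P.transpose * (b.transpose * P)) =
      P⁻¹ * (g⁻¹ * (P.transpose⁻¹ * P.transpose) * b.transpose * P) by simp only [mul_assoc],
    Matrix.nonsing_inv_mul _ hPt, Matrix.trace_mul_comm, mul_one, mul_assoc,
    Matrix.mul_nonsing_inv _ hP, mul_one]

end Matrices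

/-! ### Metric, gradient and divergence of a parametrized immersion -/

section Local

variable {m n : ℕ} {W : Type*} [NormedAddCommGroup W] [NormedSpace ℝ W]
  {W' : Type*} [NormedAddCommGroup W'] [InnerProductSpace ℝ W']

/-- The `i`-th partial derivative of a function on `ℝᵐ`. -/
def partialD (X : EuclideanSpace ℝ (Fin m) → W) (i : Fin m) (u : EuclideanSpace ℝ (Fin m)) : W :=
  fderiv ℝ X u (EuclideanSpace.single i 1)

/-- The matrix of the metric induced by `X` on an open subset of `ℝᵐ`. -/
def gramAt (X : EuclideanSpace ℝ (Fin m) → W') (u : EuclideanSpace ℝ (Fin m)) :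
    Matrix (Fin m) (Fin m) ℝ :=
  Matrix.of fun i j => ⟪partialD X i u, partialD X j u⟫_ℝ

/-- The divergence along `X` of a vector field `V`. -/
def divAt (X V : EuclideanSpace ℝ (Fin m) → W') (u : EuclideanSpace ℝ (Fin m)) : ℝ :=
  ∑ i, ∑ j, (gramAt X u)⁻¹ i j * ⟪partialD V i u, partialD X j u⟫_ℝ

/-- The coefficients of the component of the vector `w` tangent to `X` at `u`. -/
def tangCoeff (X : EuclideanSpace ℝ (Fin m) → W') (u : EuclideanSpace ℝ (Fin m)) (w : W')
    (k : Fin m) : ℝ :=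
  ∑ j, (gramAt X u)⁻¹ k j * ⟪w, partialD X j u⟫_ℝ

/-- The gradient of `φ` with respect to the metric induced by `X`. -/
def gradAt (X : EuclideanSpace ℝ (Fin m) → W') (φ : EuclideanSpace ℝ (Fin m) → ℝ)
    (u : EuclideanSpace ℝ (Fin m)) : W' :=
  ∑ i, ∑ j, ((gramAt X u)⁻¹ i j * partialD φ j u) • partialD X i u

theorem fderiv_eq_sum_partialD (X : EuclideanSpace ℝ (Fin m) → W)
    (u a : EuclideanSpace ℝ (Fin m)) : fderiv ℝ X u a = ∑ i, a i • partialD X i u := by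
  conv_lhs => rw [← (EuclideanSpace.basisFun (Fin m) ℝ).sum_repr a]
  simp [partialD]

theorem contDiffAt_partialD {X : EuclideanSpace ℝ (Fin m) → W} {u : EuclideanSpace ℝ (Fin m)}
    (hX : ContDiffAt ℝ ∞ X u) (i : Fin m) : ContDiffAt ℝ ∞ (partialD X i) u :=
  (hX.fderiv_right (m := ∞) (by simp)).clm_apply contDiffAt_const

theorem gramAt_symm (X : EuclideanSpace ℝ (Fin m) → W') (u : EuclideanSpace ℝ (Fin m)) :
    (gramAt X u).transpose = gramAt X u := by
  ext i j
  exact real_inner_comm _ _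

theorem gramAt_inv_symm (X : EuclideanSpace ℝ (Fin m) → W') (u : EuclideanSpace ℝ (Fin m))
    (i j : Fin m) : (gramAt X u)⁻¹ i j = (gramAt X u)⁻¹ j i := by
  conv_lhs => rw [← gramAt_symm, ← Matrix.transpose_nonsing_inv, Matrix.transpose_apply]

theorem gramAt_det_pos {X : EuclideanSpace ℝ (Fin m) → W'} {u : EuclideanSpace ℝ (Fin m)}
    (hX : Function.Injective (fderiv ℝ X u)) : 0 < (gramAt X u).det := by
  have hli : LinearIndependent ℝ fun i => partialD X i u := by
    have h := (EuclideanSpace.basisFun (Fin m) ℝ).toBasis.linearIndependent.map'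
      (fderiv ℝ X u).toLinearMap (LinearMap.ker_eq_bot.mpr hX)
    convert! h using 1
    ext i
    simp [partialD]
  exact (Matrix.posDef_gram_of_linearIndependent hli).det_pos

theorem contDiffAt_gramAt {X : EuclideanSpace ℝ (Fin m) → W'} {u : EuclideanSpace ℝ (Fin m)}
    (hX : ContDiffAt ℝ ∞ X u) (i j : Fin m) : ContDiffAt ℝ ∞ (fun v => gramAt X v i j) u :=
  (contDiffAt_partialD hX i).inner ℝ (contDiffAt_partialD hX j)

/-- `∑ₖ (∑ⱼ gᵏʲ aⱼ) gₖᵢ = aᵢ`. -/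
theorem sum_inv_mul_gramAt {X : EuclideanSpace ℝ (Fin m) → W'} {u : EuclideanSpace ℝ (Fin m)}
    (hX : 0 < (gramAt X u).det) (a : Fin m → ℝ) (i : Fin m) :
    ∑ k, (∑ j, (gramAt X u)⁻¹ k j * a j) * gramAt X u k i = a i := by
  have h : ∀ j, ∑ k, (gramAt X u)⁻¹ k j * gramAt X u k i = if j = i then 1 else 0 := fun j => by
    rw [Finset.sum_congr rfl fun k _ => by rw [gramAt_inv_symm X u k j], ← Matrix.mul_apply,
      Matrix.nonsing_inv_mul _ (isUnit_iff_ne_zero.mpr hX.ne'),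
      Matrix.one_apply]
  simp_rw [Finset.sum_mul]
  rw [Finset.sum_comm]
  calc _ = ∑ j, (∑ k, (gramAt X u)⁻¹ k j * gramAt X u k i) * a j :=
        Finset.sum_congr rfl fun j _ => by
          rw [Finset.sum_mul]
          exact Finset.sum_congr rfl fun k _ => by ring
    _ = a i := by simp [h]

/-- Identifies `∑ₖ tangCoeff k • ∂ₖX` as the orthogonal projection of `w`: it is tangent and has the
same pairings with the tangent vectors as `w`. -/
theorem inner_sum_tangCoeff {X : EuclideanSpace ℝ (Fin m) → W'} {u : EuclideanSpace ℝ (Fin m)}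
    (hX : 0 < (gramAt X u).det) (w : W') (i : Fin m) :
    ⟪∑ k, tangCoeff X u w k • partialD X k u, partialD X i u⟫_ℝ = ⟪w, partialD X i u⟫_ℝ := by
  simp_rw [sum_inner, real_inner_smul_left]
  exact sum_inv_mul_gramAt hX (fun j => ⟪w, partialD X j u⟫_ℝ) i

theorem tangCoeff_sum {X : EuclideanSpace ℝ (Fin m) → W'} {u : EuclideanSpace ℝ (Fin m)}
    (hX : 0 < (gramAt X u).det) (a : Fin m → ℝ) (k : Fin m) :
    tangCoeff X u (∑ i, a i • partialD X i u) k = a k := by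
  simp only [tangCoeff, sum_inner, real_inner_smul_left, Finset.mul_sum]
  rw [Finset.sum_comm]
  have h : ∀ i, ∑ j, (gramAt X u)⁻¹ k j * (a i * ⟪partialD X i u, partialD X j u⟫_ℝ)
      = if k = i then a i else 0 := fun i => by
    have : ∀ j, (gramAt X u)⁻¹ k j * (a i * ⟪partialD X i u, partialD X j u⟫_ℝ)
        = a i * ((gramAt X u)⁻¹ k j * gramAt X u j i) := fun j => by
      rw [show gramAt X u j i = ⟪partialD X i u, partialD X j u⟫_ℝ from real_inner_comm _ _]
      ring
    simp_rw [this, ← Finset.mul_sum, ← Matrix.mul_apply,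
      Matrix.nonsing_inv_mul _ (isUnit_iff_ne_zero.mpr hX.ne'), Matrix.one_apply]
    simp
  simp [h]

theorem contDiffAt_tangCoeff {X V : EuclideanSpace ℝ (Fin m) → W'}
    {u : EuclideanSpace ℝ (Fin m)} (hX : ContDiffAt ℝ ∞ X u) (hdet : 0 < (gramAt X u).det)
    (hV : ContDiffAt ℝ ∞ V u) (k : Fin m) :
    ContDiffAt ℝ ∞ (fun v => tangCoeff X v (V v) k) u :=
  ContDiffAt.sum fun j _ => (contDiffAt_inv_apply (contDiffAt_gramAt hX) hdet.ne' k j).mul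
    (hV.inner ℝ (contDiffAt_partialD hX j))

theorem contDiffAt_divAt {X V : EuclideanSpace ℝ (Fin m) → W'}
    {u : EuclideanSpace ℝ (Fin m)} (hX : ContDiffAt ℝ ∞ X u) (hdet : 0 < (gramAt X u).det)
    (hV : ContDiffAt ℝ ∞ V u) : ContDiffAt ℝ ∞ (divAt X V) u :=
  ContDiffAt.sum fun i _ => ContDiffAt.sum fun j _ =>
    (contDiffAt_inv_apply (contDiffAt_gramAt hX) hdet.ne' i j).mul
      ((contDiffAt_partialD hV i).inner ℝ (contDiffAt_partialD hX j))

theorem partialD_congr {X Y : EuclideanSpace ℝ (Fin m) → W} {u : EuclideanSpace ℝ (Fin m)}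
    (h : X =ᶠ[𝓝 u] Y) (i : Fin m) : partialD X i u = partialD Y i u := by
  rw [partialD, partialD, h.fderiv_eq]

theorem divAt_congr {X V V' : EuclideanSpace ℝ (Fin m) → W'} {u : EuclideanSpace ℝ (Fin m)}
    (h : V =ᶠ[𝓝 u] V') : divAt X V u = divAt X V' u := by
  simp only [divAt, partialD_congr h]

theorem divAt_add {X V V' : EuclideanSpace ℝ (Fin m) → W'} {u : EuclideanSpace ℝ (Fin m)}
    (h : DifferentiableAt ℝ V u) (h' : DifferentiableAt ℝ V' u) :
    divAt X (fun v => V v + V' v) u = divAt X V u + divAt X V' u := by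
  simp only [divAt, partialD, fderiv_fun_add h h', add_apply, inner_add_left,
    mul_add, Finset.sum_add_distrib]

theorem divAt_sum {ι : Type*} (s : Finset ι) {X : EuclideanSpace ℝ (Fin m) → W'}
    {V : ι → EuclideanSpace ℝ (Fin m) → W'} {u : EuclideanSpace ℝ (Fin m)}
    (h : ∀ a ∈ s, DifferentiableAt ℝ (V a) u) :
    divAt X (fun v => ∑ a ∈ s, V a v) u = ∑ a ∈ s, divAt X (V a) u := by
  classical
  induction s using Finset.induction_on with
  | empty => simp [divAt, partialD]
  | insert a s ha ih =>
    simp only [Finset.sum_insert ha]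
    rw [divAt_add (h a (Finset.mem_insert_self a s))
      (DifferentiableAt.fun_sum fun b hb => h b (Finset.mem_insert_of_mem hb)),
      ih fun b hb => h b (Finset.mem_insert_of_mem hb)]

theorem divAt_smul {X V : EuclideanSpace ℝ (Fin m) → W'} {φ : EuclideanSpace ℝ (Fin m) → ℝ}
    {u : EuclideanSpace ℝ (Fin m)}
    (hφ : DifferentiableAt ℝ φ u) (hV : DifferentiableAt ℝ V u) :
    divAt X (fun v => φ v • V v) u = φ u * divAt X V u + ⟪gradAt X φ u, V u⟫_ℝ := by
  have h : ∀ i, partialD (fun v => φ v • V v) i u = φ u • partialD V i u + partialD φ i u • V u :=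
    fun i => by
      simp only [partialD]
      rw [fderiv_fun_smul hφ hV]
      simp
  simp only [divAt, gradAt, h, inner_add_left, real_inner_smul_left, sum_inner, mul_add,
    Finset.sum_add_distrib, Finset.mul_sum]
  congr 1
  · exact Finset.sum_congr rfl fun i _ => Finset.sum_congr rfl fun j _ => by ring
  · rw [Finset.sum_comm]
    refine Finset.sum_congr rfl fun i _ => Finset.sum_congr rfl fun j _ => ?_
    rw [gramAt_inv_symm X u j i, real_inner_comm (V u)]
    ring

/-- For a field `N` normal to `X`, the divergence is minus the trace of the pairing of `N` with the
second derivatives of `X`. -/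
theorem divAt_of_normal {X N : EuclideanSpace ℝ (Fin m) → W'} {u : EuclideanSpace ℝ (Fin m)}
    (hX : ContDiffAt ℝ ∞ X u) (hN : DifferentiableAt ℝ N u)
    (h : ∀ᶠ v in 𝓝 u, ∀ j, ⟪N v, partialD X j v⟫_ℝ = 0) :
    divAt X N u = -∑ i, ∑ j, (gramAt X u)⁻¹ i j * ⟪partialD (partialD X i) j u, N u⟫_ℝ := by
  -- Differentiate `⟨N, ∂ⱼX⟩ = 0` in the direction `i`.
  have key : ∀ i j, ⟪partialD N i u, partialD X j u⟫_ℝ = -⟪partialD (partialD X j) i u, N u⟫_ℝ := by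
    intro i j
    have h0 : fderiv ℝ (fun v => ⟪N v, partialD X j v⟫_ℝ) u = 0 := by
      rw [Filter.EventuallyEq.fderiv_eq (f := fun _ => (0 : ℝ)) (h.mono fun v hv => hv j)]
      simp
    have h1 := congrArg (fun L => L (EuclideanSpace.single i (1 : ℝ))) h0
    rw [fderiv_inner_apply ℝ hN ((contDiffAt_partialD hX j).differentiableAt (by simp))] at h1
    rw [real_inner_comm (N u)]
    rw [zero_apply] at h1
    simp only [partialD] at h1 ⊢
    linarith
  simp only [divAt, key]
  rw [Finset.sum_comm, ← Finset.sum_neg_distrib]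
  refine Finset.sum_congr rfl fun i _ => ?_
  rw [← Finset.sum_neg_distrib]
  refine Finset.sum_congr rfl fun j _ => ?_
  rw [gramAt_inv_symm X u j i]
  ring

theorem partialD_comm {X : EuclideanSpace ℝ (Fin m) → W} {u : EuclideanSpace ℝ (Fin m)}
    (hX : ContDiffAt ℝ ∞ X u) (i j : Fin m) :
    partialD (partialD X i) j u = partialD (partialD X j) i u := by
  have hd : DifferentiableAt ℝ (fderiv ℝ X) u :=
    (hX.fderiv_right (m := ∞) (by simp)).differentiableAt (by simp)
  have h : ∀ i j, partialD (partialD X i) j u =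
      fderiv ℝ (fderiv ℝ X) u (EuclideanSpace.single j 1) (EuclideanSpace.single i 1) := by
    intro i j
    have := (hd.hasFDerivAt.clm_apply (hasFDerivAt_const (EuclideanSpace.single i (1:ℝ)) u)).fderiv
    simp only [partialD]
    erw [this]
    simp
  rw [h, h]
  exact (hX.isSymmSndFDerivAt
    (by simpa using WithTop.coe_le_coe.mpr (le_top : (2 : ℕ∞) ≤ ⊤))).eq _ _

/-- The derivative of a Gram matrix has this symmetrized form. Its two terms have the same trace
against the symmetric `g⁻¹`, which absorbs the `1/2` coming from the square root. Used for both the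
space and the time derivative of `√det g`. -/
theorem trace_inv_mul_symm {g : Matrix (Fin m) (Fin m) ℝ} (hg : ∀ i j, g⁻¹ i j = g⁻¹ j i)
    (p q : Fin m → W') :
    (g⁻¹ * Matrix.of fun i j => ⟪p i, q j⟫_ℝ + ⟪q i, p j⟫_ℝ).trace / 2 =
      ∑ i, ∑ j, g⁻¹ i j * ⟪p i, q j⟫_ℝ := by
  have h : ∑ i, ∑ j, g⁻¹ i j * ⟪q i, p j⟫_ℝ = ∑ i, ∑ j, g⁻¹ i j * ⟪p i, q j⟫_ℝ := by
    rw [Finset.sum_comm]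
    refine Finset.sum_congr rfl fun i _ => Finset.sum_congr rfl fun j _ => ?_
    rw [hg j i, real_inner_comm]
  have h' : (g⁻¹ * Matrix.of fun i j => ⟪p i, q j⟫_ℝ + ⟪q i, p j⟫_ℝ).trace =
      ∑ i, ∑ j, g⁻¹ i j * ⟪q i, p j⟫_ℝ + ∑ i, ∑ j, g⁻¹ i j * ⟪p i, q j⟫_ℝ := by
    simp only [Matrix.trace, Matrix.diag_apply, Matrix.mul_apply, Matrix.of_apply, mul_add,
      Finset.sum_add_distrib]
    congr 1 <;> exact Finset.sum_congr rfl fun i _ => Finset.sum_congr rfl fun j _ => by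
      rw [real_inner_comm]
  rw [h', h]
  ring

theorem hasDerivAt_line {φ : EuclideanSpace ℝ (Fin m) → W} {u : EuclideanSpace ℝ (Fin m)}
    (hφ : DifferentiableAt ℝ φ u) (k : Fin m) :
    HasDerivAt (fun s : ℝ => φ (u + s • EuclideanSpace.single k 1)) (partialD φ k u) 0 :=
  hφ.hasFDerivAt.hasLineDerivAt _

/-- The partial derivative of `√det g`. -/
theorem partialD_sqrt_det {X : EuclideanSpace ℝ (Fin m) → W'} {u : EuclideanSpace ℝ (Fin m)}
    (hX : ContDiffAt ℝ ∞ X u) (hdet : 0 < (gramAt X u).det) (k : Fin m) :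
    partialD (fun v => √(gramAt X v).det) k u =
      √(gramAt X u).det * ∑ i, ∑ j, (gramAt X u)⁻¹ i j *
        ⟪partialD (partialD X i) k u, partialD X j u⟫_ℝ := by
  have hd : DifferentiableAt ℝ (fun v => √(gramAt X v).det) u :=
    ((contDiffAt_det (contDiffAt_gramAt hX)).sqrt hdet.ne').differentiableAt (by simp)
  have hu : u + (0 : ℝ) • EuclideanSpace.single k (1 : ℝ) = u := by simp
  have h2 : ∀ i, HasDerivAt (fun s : ℝ => partialD X i (u + s • EuclideanSpace.single k 1))
      (partialD (partialD X i) k u) 0 := fun i =>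
    hasDerivAt_line ((contDiffAt_partialD hX i).differentiableAt (by simp)) k
  -- The one-variable formula, applied along the coordinate line `u + s eₖ` at `s = 0`.
  have h1 := hasDerivAt_sqrt_det (t := 0)
    (G := fun s : ℝ => gramAt X (u + s • EuclideanSpace.single k 1))
    (G' := Matrix.of fun i j => ⟪partialD (partialD X i) k u, partialD X j u⟫_ℝ +
      ⟪partialD X i u, partialD (partialD X j) k u⟫_ℝ)
    (fun i j => by
      have := (h2 i).inner ℝ (h2 j)
      rw [hu] at this
      rw [Matrix.of_apply, add_comm]
      exact this) (by rwa [hu])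
  rw [hu, trace_inv_mul_symm (gramAt_inv_symm X u)] at h1
  exact (hasDerivAt_line hd k).unique h1

/-- The divergence of a tangent vector field in coordinates. -/
theorem divAt_tangent {X V : EuclideanSpace ℝ (Fin m) → W'}
    {a : Fin m → EuclideanSpace ℝ (Fin m) → ℝ} {u : EuclideanSpace ℝ (Fin m)}
    (hX : ContDiffAt ℝ ∞ X u) (hdet : 0 < (gramAt X u).det)
    (ha : ∀ k, DifferentiableAt ℝ (a k) u)
    (hV : V =ᶠ[𝓝 u] fun v => ∑ k, a k v • partialD X k v) :
    divAt X V u * √(gramAt X u).det = ∑ k, partialD (fun v => √(gramAt X v).det * a k v) k u := by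
  have hp : ∀ k, DifferentiableAt ℝ (partialD X k) u := fun k =>
    (contDiffAt_partialD hX k).differentiableAt (by simp)
  have hd : DifferentiableAt ℝ (fun v => √(gramAt X v).det) u :=
    ((contDiffAt_det (contDiffAt_gramAt hX)).sqrt hdet.ne').differentiableAt (by simp)
  -- The Leibniz rule will leave two kinds of terms: `⟨∇aᵏ, ∂ₖX⟩ = ∂ₖaᵏ`, and `aᵏ div(∂ₖX)`. For the
  -- second, `∂ᵢ∂ₖX = ∂ₖ∂ᵢX` turns `√(det g) div(∂ₖX)` into `∂ₖ√(det g)`.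
  have hgrad : ∀ k, ⟪gradAt X (a k) u, partialD X k u⟫_ℝ = partialD (a k) k u := fun k => by
    rw [← sum_inv_mul_gramAt hdet (fun j => partialD (a k) j u) k]
    simp only [gradAt, sum_inner, real_inner_smul_left, Finset.sum_mul]
    rfl
  have hdiv : ∀ k, √(gramAt X u).det * divAt X (partialD X k) u =
      partialD (fun v => √(gramAt X v).det) k u := fun k => by
    rw [partialD_sqrt_det hX hdet]
    simp only [divAt, partialD_comm hX k]
  rw [divAt_congr hV, divAt_sum (V := fun k v => a k v • partialD X k v) _
    fun k _ => (ha k).smul (hp k), Finset.sum_mul]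
  refine Finset.sum_congr rfl fun k _ => ?_
  rw [divAt_smul (ha k) (hp k), hgrad, add_mul, mul_assoc, mul_comm (divAt _ _ _), hdiv]
  simp only [partialD]
  rw [fderiv_fun_mul hd (ha k)]
  simp only [add_apply, smul_apply, smul_eq_mul]
  ring

end Local

/-! ### Charts and independence of coordinates -/

section Charts

variable {m n : ℕ} {M : Type*} [TopologicalSpace M] [ChartedSpace (EuclideanSpace ℝ (Fin m)) M]
  {W : Type*} [NormedAddCommGroup W] [NormedSpace ℝ W]
  {W' : Type*} [NormedAddCommGroup W'] [InnerProductSpace ℝ W']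

/-- The function `φ` in the coordinates of the preferred chart around `q`. -/
def inChart (m : ℕ) [ChartedSpace (EuclideanSpace ℝ (Fin m)) M] {W : Type*} (φ : M → W) (q : M) :
    EuclideanSpace ℝ (Fin m) → W :=
  fun v => φ ((chartAt (EuclideanSpace ℝ (Fin m)) q).symm v)

theorem inChart_chartAt {W : Type*} (φ : M → W) {q r : M}
    (hr : r ∈ (chartAt (EuclideanSpace ℝ (Fin m)) q).source) :
    inChart m φ q (chartAt (EuclideanSpace ℝ (Fin m)) q r) = φ r := by
  simp [inChart, hr]

/-- Smoothness of a function on `M`, in the coordinates of each preferred chart. -/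
def ChartSmooth (m : ℕ) [ChartedSpace (EuclideanSpace ℝ (Fin m)) M] (φ : M → W) : Prop :=
  ∀ q : M, ∀ u ∈ (chartAt (EuclideanSpace ℝ (Fin m)) q).target, ContDiffAt ℝ ∞ (inChart m φ q) u

theorem ChartSmooth.of_contMDiff [IsManifold (𝓡 m) ∞ M] {φ : M → W}
    (hφ : ContMDiff (𝓡 m) 𝓘(ℝ, W) ∞ φ) : ChartSmooth m φ := by
  intro q u hu
  have h : ContMDiffOn (𝓡 m) 𝓘(ℝ, W) ∞ (inChart m φ q)
      (chartAt (EuclideanSpace ℝ (Fin m)) q).target :=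
    hφ.comp_contMDiffOn contMDiffOn_chart_symm
  exact (contMDiffOn_iff_contDiffOn.mp h).contDiffAt
    ((chartAt (EuclideanSpace ℝ (Fin m)) q).open_target.mem_nhds hu)

theorem ChartSmooth.continuous {φ : M → W} (hφ : ChartSmooth m φ) : Continuous φ := by
  refine continuous_iff_continuousAt.mpr fun q => ?_
  have h := (hφ q _ (mem_chart_target _ q)).continuousAt.comp
    ((chartAt (EuclideanSpace ℝ (Fin m)) q).continuousAt (mem_chart_source _ q))
  refine h.congr ?_
  filter_upwards [chart_source_mem_nhds (EuclideanSpace ℝ (Fin m)) q] with r hr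
  exact inChart_chartAt φ hr

/-- The transition map from the chart around `q₀` to the chart around `q₁`. -/
def transition (m : ℕ) [ChartedSpace (EuclideanSpace ℝ (Fin m)) M] (q₀ q₁ : M) :
    EuclideanSpace ℝ (Fin m) → EuclideanSpace ℝ (Fin m) :=
  inChart m (chartAt (EuclideanSpace ℝ (Fin m)) q₁) q₀

section

variable {q₀ q₁ r : M}

theorem transition_apply (q₁ : M) (h₀ : r ∈ (chartAt (EuclideanSpace ℝ (Fin m)) q₀).source) :
    transition m q₀ q₁ (chartAt (EuclideanSpace ℝ (Fin m)) q₀ r) =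
      chartAt (EuclideanSpace ℝ (Fin m)) q₁ r :=
  inChart_chartAt _ h₀

theorem eventually_symm_mem_source
    (h₀ : r ∈ (chartAt (EuclideanSpace ℝ (Fin m)) q₀).source)
    (h₁ : r ∈ (chartAt (EuclideanSpace ℝ (Fin m)) q₁).source) :
    ∀ᶠ v in 𝓝 (chartAt (EuclideanSpace ℝ (Fin m)) q₀ r),
      (chartAt (EuclideanSpace ℝ (Fin m)) q₀).symm v ∈
        (chartAt (EuclideanSpace ℝ (Fin m)) q₁).source := by
  refine ((chartAt (EuclideanSpace ℝ (Fin m)) q₀).continuousAt_symm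
    ((chartAt (EuclideanSpace ℝ (Fin m)) q₀).map_source h₀)).eventually_mem ?_
  rw [(chartAt (EuclideanSpace ℝ (Fin m)) q₀).left_inv h₀]
  exact (chartAt (EuclideanSpace ℝ (Fin m)) q₁).open_source.mem_nhds h₁

theorem inChart_eventuallyEq {W : Type*} (φ : M → W)
    (h₀ : r ∈ (chartAt (EuclideanSpace ℝ (Fin m)) q₀).source)
    (h₁ : r ∈ (chartAt (EuclideanSpace ℝ (Fin m)) q₁).source) :
    inChart m φ q₀ =ᶠ[𝓝 (chartAt (EuclideanSpace ℝ (Fin m)) q₀ r)]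
      inChart m φ q₁ ∘ transition m q₀ q₁ := by
  filter_upwards [eventually_symm_mem_source h₀ h₁] with v hv
  exact (inChart_chartAt φ hv).symm

/-- The Jacobian matrix of the transition map. -/
def transitionMatrix (m : ℕ) [ChartedSpace (EuclideanSpace ℝ (Fin m)) M] (q₀ q₁ : M)
    (u : EuclideanSpace ℝ (Fin m)) : Matrix (Fin m) (Fin m) ℝ :=
  LinearMap.toMatrix (EuclideanSpace.basisFun (Fin m) ℝ).toBasis
    (EuclideanSpace.basisFun (Fin m) ℝ).toBasis (fderiv ℝ (transition m q₀ q₁) u).toLinearMap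

theorem transitionMatrix_det (q₀ q₁ : M) (u : EuclideanSpace ℝ (Fin m)) :
    (transitionMatrix m q₀ q₁ u).det = (fderiv ℝ (transition m q₀ q₁) u).det :=
  LinearMap.det_toMatrix _ _

variable [IsManifold (𝓡 m) ∞ M]

theorem contDiffAt_transition
    (h₀ : r ∈ (chartAt (EuclideanSpace ℝ (Fin m)) q₀).source)
    (h₁ : r ∈ (chartAt (EuclideanSpace ℝ (Fin m)) q₁).source) :
    ContDiffAt ℝ ∞ (transition m q₀ q₁) (chartAt (EuclideanSpace ℝ (Fin m)) q₀ r) := by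
  have h2 := (contMDiffOn_chart_symm (I := 𝓡 m) (n := ∞) (x := q₀)).contMDiffAt
    ((chartAt (EuclideanSpace ℝ (Fin m)) q₀).open_target.mem_nhds
      ((chartAt (EuclideanSpace ℝ (Fin m)) q₀).map_source h₀))
  have h3 := (contMDiffOn_chart (I := 𝓡 m) (n := ∞) (x := q₁)).contMDiffAt
    ((chartAt (EuclideanSpace ℝ (Fin m)) q₁).open_source.mem_nhds h₁)
  rw [← (chartAt (EuclideanSpace ℝ (Fin m)) q₀).left_inv h₀] at h3
  exact contMDiffAt_iff_contDiffAt.mp (h3.comp _ h2)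

theorem fderiv_inChart {φ : M → W}
    (h₀ : r ∈ (chartAt (EuclideanSpace ℝ (Fin m)) q₀).source)
    (h₁ : r ∈ (chartAt (EuclideanSpace ℝ (Fin m)) q₁).source)
    (hφ : DifferentiableAt ℝ (inChart m φ q₁) (chartAt (EuclideanSpace ℝ (Fin m)) q₁ r)) :
    fderiv ℝ (inChart m φ q₀) (chartAt (EuclideanSpace ℝ (Fin m)) q₀ r) =
      (fderiv ℝ (inChart m φ q₁) (chartAt (EuclideanSpace ℝ (Fin m)) q₁ r)).comp
        (fderiv ℝ (transition m q₀ q₁) (chartAt (EuclideanSpace ℝ (Fin m)) q₀ r)) := by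
  rw [(inChart_eventuallyEq φ h₀ h₁).fderiv_eq, fderiv_comp, transition_apply _ h₀]
  · rwa [transition_apply _ h₀]
  · exact (contDiffAt_transition h₀ h₁).differentiableAt (by simp)

theorem fderiv_transition_comp
    (h₀ : r ∈ (chartAt (EuclideanSpace ℝ (Fin m)) q₀).source)
    (h₁ : r ∈ (chartAt (EuclideanSpace ℝ (Fin m)) q₁).source) :
    (fderiv ℝ (transition m q₁ q₀) (chartAt (EuclideanSpace ℝ (Fin m)) q₁ r)).comp
      (fderiv ℝ (transition m q₀ q₁) (chartAt (EuclideanSpace ℝ (Fin m)) q₀ r)) =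
      ContinuousLinearMap.id ℝ _ := by
  -- A transition map is a chart read in another chart, so the chain rule for functions on `M`
  -- applies to it. The composite is the derivative of the chart around `q₀` read in itself, which
  -- is the identity near the point.
  rw [transition, ← fderiv_inChart h₀ h₁
    ((contDiffAt_transition h₁ h₀).differentiableAt (by simp)), ← fderiv_id]
  refine Filter.EventuallyEq.fderiv_eq ?_
  filter_upwards [(chartAt (EuclideanSpace ℝ (Fin m)) q₀).open_target.mem_nhds
    ((chartAt (EuclideanSpace ℝ (Fin m)) q₀).map_source h₀)] with v hv
  exact (chartAt (EuclideanSpace ℝ (Fin m)) q₀).right_inv hv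

theorem isUnit_det_transitionMatrix
    (h₀ : r ∈ (chartAt (EuclideanSpace ℝ (Fin m)) q₀).source)
    (h₁ : r ∈ (chartAt (EuclideanSpace ℝ (Fin m)) q₁).source) :
    IsUnit (transitionMatrix m q₀ q₁ (chartAt (EuclideanSpace ℝ (Fin m)) q₀ r)).det := by
  have h : transitionMatrix m q₁ q₀ (chartAt (EuclideanSpace ℝ (Fin m)) q₁ r) *
      transitionMatrix m q₀ q₁ (chartAt (EuclideanSpace ℝ (Fin m)) q₀ r) = 1 := by
    rw [transitionMatrix, transitionMatrix, ← LinearMap.toMatrix_comp]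
    have := congrArg ContinuousLinearMap.toLinearMap (fderiv_transition_comp h₀ h₁)
    rw [ContinuousLinearMap.toLinearMap_comp] at this
    rw [this]
    exact LinearMap.toMatrix_id _
  exact isUnit_iff_exists_inv'.mpr ⟨_, by rw [← Matrix.det_mul, h, Matrix.det_one]⟩

theorem partialD_inChart {φ : M → W}
    (h₀ : r ∈ (chartAt (EuclideanSpace ℝ (Fin m)) q₀).source)
    (h₁ : r ∈ (chartAt (EuclideanSpace ℝ (Fin m)) q₁).source)
    (hφ : DifferentiableAt ℝ (inChart m φ q₁) (chartAt (EuclideanSpace ℝ (Fin m)) q₁ r))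
    (i : Fin m) :
    partialD (inChart m φ q₀) i (chartAt (EuclideanSpace ℝ (Fin m)) q₀ r) =
      ∑ k, transitionMatrix m q₀ q₁ (chartAt (EuclideanSpace ℝ (Fin m)) q₀ r) k i •
        partialD (inChart m φ q₁) k (chartAt (EuclideanSpace ℝ (Fin m)) q₁ r) := by
  rw [partialD, fderiv_inChart h₀ h₁ hφ, ContinuousLinearMap.comp_apply, fderiv_eq_sum_partialD]
  simp [transitionMatrix, LinearMap.toMatrix_apply]

/-- Stated for two maps so that it covers both the metric (`φ = ψ = x`) and the bilinear form `⟨∂ᵢV,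
∂ⱼx⟩` whose trace is the divergence. -/
theorem inner_partialD_inChart {φ ψ : M → W'}
    (h₀ : r ∈ (chartAt (EuclideanSpace ℝ (Fin m)) q₀).source)
    (h₁ : r ∈ (chartAt (EuclideanSpace ℝ (Fin m)) q₁).source)
    (hφ : DifferentiableAt ℝ (inChart m φ q₁) (chartAt (EuclideanSpace ℝ (Fin m)) q₁ r))
    (hψ : DifferentiableAt ℝ (inChart m ψ q₁) (chartAt (EuclideanSpace ℝ (Fin m)) q₁ r)) :
    (Matrix.of fun i j => ⟪partialD (inChart m φ q₀) i (chartAt (EuclideanSpace ℝ (Fin m)) q₀ r),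
        partialD (inChart m ψ q₀) j (chartAt (EuclideanSpace ℝ (Fin m)) q₀ r)⟫_ℝ) =
      (transitionMatrix m q₀ q₁ (chartAt (EuclideanSpace ℝ (Fin m)) q₀ r)).transpose *
      (Matrix.of fun i j => ⟪partialD (inChart m φ q₁) i (chartAt (EuclideanSpace ℝ (Fin m)) q₁ r),
        partialD (inChart m ψ q₁) j (chartAt (EuclideanSpace ℝ (Fin m)) q₁ r)⟫_ℝ) *
      transitionMatrix m q₀ q₁ (chartAt (EuclideanSpace ℝ (Fin m)) q₀ r) := by
  ext i j
  simp only [Matrix.of_apply, partialD_inChart h₀ h₁ hφ, partialD_inChart h₀ h₁ hψ, sum_inner,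
    inner_sum, real_inner_smul_left, real_inner_smul_right, Matrix.mul_apply,
    Matrix.transpose_apply, Finset.sum_mul]
  exact Finset.sum_congr rfl fun k _ => Finset.sum_congr rfl fun l _ => by ring

theorem gramAt_inChart {x : M → W'}
    (h₀ : r ∈ (chartAt (EuclideanSpace ℝ (Fin m)) q₀).source)
    (h₁ : r ∈ (chartAt (EuclideanSpace ℝ (Fin m)) q₁).source)
    (hx : DifferentiableAt ℝ (inChart m x q₁) (chartAt (EuclideanSpace ℝ (Fin m)) q₁ r)) :
    gramAt (inChart m x q₀) (chartAt (EuclideanSpace ℝ (Fin m)) q₀ r) =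
      (transitionMatrix m q₀ q₁ (chartAt (EuclideanSpace ℝ (Fin m)) q₀ r)).transpose *
      gramAt (inChart m x q₁) (chartAt (EuclideanSpace ℝ (Fin m)) q₁ r) *
      transitionMatrix m q₀ q₁ (chartAt (EuclideanSpace ℝ (Fin m)) q₀ r) :=
  inner_partialD_inChart h₀ h₁ hx hx

/-- The factor is the absolute Jacobian of the transition map, exactly what change of variables in
the integral supplies. -/
theorem sqrt_det_gramAt_inChart {x : M → W'}
    (h₀ : r ∈ (chartAt (EuclideanSpace ℝ (Fin m)) q₀).source)
    (h₁ : r ∈ (chartAt (EuclideanSpace ℝ (Fin m)) q₁).source)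
    (hx : DifferentiableAt ℝ (inChart m x q₁) (chartAt (EuclideanSpace ℝ (Fin m)) q₁ r)) :
    √(gramAt (inChart m x q₀) (chartAt (EuclideanSpace ℝ (Fin m)) q₀ r)).det =
      |(fderiv ℝ (transition m q₀ q₁) (chartAt (EuclideanSpace ℝ (Fin m)) q₀ r)).det| *
        √(gramAt (inChart m x q₁) (chartAt (EuclideanSpace ℝ (Fin m)) q₁ r)).det := by
  rw [gramAt_inChart h₀ h₁ hx, Matrix.det_mul, Matrix.det_mul, Matrix.det_transpose,
    transitionMatrix_det, mul_right_comm, Real.sqrt_mul (mul_self_nonneg _),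
    Real.sqrt_mul_self_eq_abs]

/-- The divergence along `x` does not depend on the chart. -/
theorem divAt_inChart {x V : M → W'}
    (h₀ : r ∈ (chartAt (EuclideanSpace ℝ (Fin m)) q₀).source)
    (h₁ : r ∈ (chartAt (EuclideanSpace ℝ (Fin m)) q₁).source)
    (hx : DifferentiableAt ℝ (inChart m x q₁) (chartAt (EuclideanSpace ℝ (Fin m)) q₁ r))
    (hV : DifferentiableAt ℝ (inChart m V q₁) (chartAt (EuclideanSpace ℝ (Fin m)) q₁ r)) :
    divAt (inChart m x q₀) (inChart m V q₀) (chartAt (EuclideanSpace ℝ (Fin m)) q₀ r) =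
      divAt (inChart m x q₁) (inChart m V q₁) (chartAt (EuclideanSpace ℝ (Fin m)) q₁ r) := by
  have h := sum_inv_congr
    (gramAt (inChart m x q₁) (chartAt (EuclideanSpace ℝ (Fin m)) q₁ r)) _ (Matrix.of fun i j =>
    ⟪partialD (inChart m V q₁) i (chartAt (EuclideanSpace ℝ (Fin m)) q₁ r),
      partialD (inChart m x q₁) j (chartAt (EuclideanSpace ℝ (Fin m)) q₁ r)⟫_ℝ)
    (isUnit_det_transitionMatrix h₀ h₁)
  rw [← gramAt_inChart h₀ h₁ hx, ← inner_partialD_inChart h₀ h₁ hV hx] at h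
  exact h

end

section Immersion

variable {x : M → EuclideanSpace ℝ (Fin n)}

theorem mfderiv_eq_fderiv_inChart (hx : ContMDiff (𝓡 m) (𝓡 n) ∞ x) (q : M) :
    mfderiv (𝓡 m) (𝓡 n) x q =
      fderiv ℝ (inChart m x q) (chartAt (EuclideanSpace ℝ (Fin m)) q q) := by
  rw [(hx.mdifferentiableAt (by simp)).mfderiv]
  simp only [mfld_simps, fderivWithin_univ]
  rfl

variable [IsManifold (𝓡 m) ∞ M]

/-- The definition uses the preferred chart at `r` itself. The chain rule through the transition
maps in both directions gives the two inclusions, so one chart can describe the tangent planes at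
all of its points. -/
theorem tangentPlane_eq (hx : ContMDiff (𝓡 m) (𝓡 n) ∞ x) {q r : M}
    (hr : r ∈ (chartAt (EuclideanSpace ℝ (Fin m)) q).source) :
    tangentPlane m x r = LinearMap.range
      (fderiv ℝ (inChart m x q) (chartAt (EuclideanSpace ℝ (Fin m)) q r)).toLinearMap := by
  have hr' := mem_chart_source (EuclideanSpace ℝ (Fin m)) r
  have hs := ChartSmooth.of_contMDiff hx
  have hd : ∀ q, r ∈ (chartAt (EuclideanSpace ℝ (Fin m)) q).source →
      DifferentiableAt ℝ (inChart m x q) (chartAt (EuclideanSpace ℝ (Fin m)) q r) := fun q h =>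
    (hs q _ ((chartAt (EuclideanSpace ℝ (Fin m)) q).map_source h)).differentiableAt (by simp)
  have hle : ∀ q₀ q₁, r ∈ (chartAt (EuclideanSpace ℝ (Fin m)) q₀).source →
      r ∈ (chartAt (EuclideanSpace ℝ (Fin m)) q₁).source →
      LinearMap.range
        (fderiv ℝ (inChart m x q₀) (chartAt (EuclideanSpace ℝ (Fin m)) q₀ r)).toLinearMap ≤
      LinearMap.range
        (fderiv ℝ (inChart m x q₁) (chartAt (EuclideanSpace ℝ (Fin m)) q₁ r)).toLinearMap := by
    intro q₀ q₁ h₀ h₁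
    rw [fderiv_inChart h₀ h₁ (hd q₁ h₁), ContinuousLinearMap.toLinearMap_comp]
    exact LinearMap.range_comp_le_range _ _
  rw [tangentPlane, mfderiv_eq_fderiv_inChart hx]
  exact le_antisymm (hle r q hr' hr) (hle q r hr hr')

theorem IsImmersedSubmanifold.injective_fderiv (hx : IsImmersedSubmanifold m x) {q r : M}
    (hr : r ∈ (chartAt (EuclideanSpace ℝ (Fin m)) q).source) :
    Function.Injective
      (fderiv ℝ (inChart m x q) (chartAt (EuclideanSpace ℝ (Fin m)) q r)) := by
  have hr' := mem_chart_source (EuclideanSpace ℝ (Fin m)) r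
  have hs := ChartSmooth.of_contMDiff hx.smooth
  rw [fderiv_inChart hr hr' ((hs r _ (mem_chart_target _ r)).differentiableAt (by simp)),
    ContinuousLinearMap.coe_comp]
  refine Function.Injective.comp ?_ ?_
  · rw [← mfderiv_eq_fderiv_inChart hx.smooth]
    exact hx.injective_mfderiv r
  · refine Function.LeftInverse.injective (g := fderiv ℝ (transition m r q)
      (chartAt (EuclideanSpace ℝ (Fin m)) r r)) fun a => ?_
    exact congrArg (fun L => L a) (fderiv_transition_comp hr hr')

theorem IsImmersedSubmanifold.gramAt_det_pos (hx : IsImmersedSubmanifold m x) {q : M}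
    {u : EuclideanSpace ℝ (Fin m)} (hu : u ∈ (chartAt (EuclideanSpace ℝ (Fin m)) q).target) :
    0 < (gramAt (inChart m x q) u).det := by
  have h := hx.injective_fderiv ((chartAt (EuclideanSpace ℝ (Fin m)) q).map_target hu)
  rw [(chartAt (EuclideanSpace ℝ (Fin m)) q).right_inv hu] at h
  exact FirstVariation.gramAt_det_pos h

theorem IsImmersedSubmanifold.chartSmooth (hx : IsImmersedSubmanifold m x) : ChartSmooth m x :=
  ChartSmooth.of_contMDiff hx.smooth

end Immersion

end Charts

/-! ### The volume measure and its dependence on the immersion -/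

section Volume

variable {m n : ℕ} {M : Type*} [TopologicalSpace M] [ChartedSpace (EuclideanSpace ℝ (Fin m)) M]
  {x y : M → EuclideanSpace ℝ (Fin n)}

theorem metricMatrix_eq (x : M → EuclideanSpace ℝ (Fin n)) (q : M) :
    metricMatrix (m := m) x q = gramAt (inChart m x q) := rfl

theorem continuousOn_sqrt_det [IsManifold (𝓡 m) ∞ M] (hx : IsImmersedSubmanifold m x) (q : M) :
    ContinuousOn (fun u => √(gramAt (inChart m x q) u).det)
      (chartAt (EuclideanSpace ℝ (Fin m)) q).target := fun u hu =>
  ((contDiffAt_det (contDiffAt_gramAt (hx.chartSmooth q u hu))).continuousAt.sqrt).continuousWithinAt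

/-- The ratio of the volume densities of two immersions `x`, `y`. -/
def volRatio (m : ℕ) [ChartedSpace (EuclideanSpace ℝ (Fin m)) M]
    (x y : M → EuclideanSpace ℝ (Fin n)) (r : M) : ℝ :=
  √(gramAt (inChart m y r) (chartAt (EuclideanSpace ℝ (Fin m)) r r)).det /
    √(gramAt (inChart m x r) (chartAt (EuclideanSpace ℝ (Fin m)) r r)).det

theorem volRatio_nonneg (x y : M → EuclideanSpace ℝ (Fin n)) (r : M) : 0 ≤ volRatio m x y r := by
  unfold volRatio; positivity

theorem continuous_of_inChart {Y : Type*} [TopologicalSpace Y] {ψ : M → Y}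
    (h : ∀ q : M, ContinuousAt (inChart m ψ q) (chartAt (EuclideanSpace ℝ (Fin m)) q q)) :
    Continuous ψ := by
  refine continuous_iff_continuousAt.mpr fun q => ?_
  have h := (h q).comp
    ((chartAt (EuclideanSpace ℝ (Fin m)) q).continuousAt (mem_chart_source _ q))
  refine h.congr ?_
  filter_upwards [chart_source_mem_nhds (EuclideanSpace ℝ (Fin m)) q] with r hr
  exact inChart_chartAt ψ hr

section

variable [IsManifold (𝓡 m) ∞ M]

/-- The Jacobian factors of numerator and denominator cancel. This gives one formula valid on a
whole chart domain, whereas the preferred chart in the definition varies with the point. -/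
theorem volRatio_eq (hx : IsImmersedSubmanifold m x) (hy : IsImmersedSubmanifold m y) {q r : M}
    (hr : r ∈ (chartAt (EuclideanSpace ℝ (Fin m)) q).source) :
    volRatio m x y r = √(gramAt (inChart m y q) (chartAt (EuclideanSpace ℝ (Fin m)) q r)).det /
      √(gramAt (inChart m x q) (chartAt (EuclideanSpace ℝ (Fin m)) q r)).det := by
  have hr' := mem_chart_source (EuclideanSpace ℝ (Fin m)) r
  have hu := (chartAt (EuclideanSpace ℝ (Fin m)) q).map_source hr
  rw [volRatio, sqrt_det_gramAt_inChart hr' hr ((hx.chartSmooth q _ hu).differentiableAt (by simp)),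
    sqrt_det_gramAt_inChart hr' hr ((hy.chartSmooth q _ hu).differentiableAt (by simp))]
  refine mul_div_mul_left _ _ ?_
  rw [abs_ne_zero, ← transitionMatrix_det]
  exact (isUnit_det_transitionMatrix hr' hr).ne_zero

theorem continuous_volRatio (hx : IsImmersedSubmanifold m x) (hy : IsImmersedSubmanifold m y) :
    Continuous (volRatio m x y) := by
  refine continuous_of_inChart (m := m) fun q => ?_
  have hq := mem_chart_target (EuclideanSpace ℝ (Fin m)) q
  have hmem := (chartAt (EuclideanSpace ℝ (Fin m)) q).open_target.mem_nhds hq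
  refine (((continuousOn_sqrt_det hy q).continuousAt hmem).div
    ((continuousOn_sqrt_det hx q).continuousAt hmem)
      (Real.sqrt_pos.mpr (hx.gramAt_det_pos hq)).ne').congr ?_
  filter_upwards [hmem] with u hu
  have := volRatio_eq hx hy ((chartAt (EuclideanSpace ℝ (Fin m)) q).map_target hu)
  rw [(chartAt (EuclideanSpace ℝ (Fin m)) q).right_inv hu] at this
  exact this.symm

theorem aemeasurable_sqrt_det (hx : IsImmersedSubmanifold m x) (q : M) :
    AEMeasurable (fun u => √(gramAt (inChart m x q) u).det)
      (volume.restrict (chartAt (EuclideanSpace ℝ (Fin m)) q).target) :=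
  (continuousOn_sqrt_det hx q).aemeasurable
    (chartAt (EuclideanSpace ℝ (Fin m)) q).open_target.measurableSet

end

variable [MeasurableSpace M] [BorelSpace M]

theorem aemeasurable_chart_symm (q : M) :
    AEMeasurable (chartAt (EuclideanSpace ℝ (Fin m)) q).symm
      (volume.restrict (chartAt (EuclideanSpace ℝ (Fin m)) q).target) :=
  (chartAt (EuclideanSpace ℝ (Fin m)) q).continuousOn_symm.aemeasurable
    (chartAt (EuclideanSpace ℝ (Fin m)) q).open_target.measurableSet

theorem measurableSet_target_inter_symm_preimage (q : M) {A : Set M} (hA : MeasurableSet A) :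
    MeasurableSet ((chartAt (EuclideanSpace ℝ (Fin m)) q).target ∩
      (chartAt (EuclideanSpace ℝ (Fin m)) q).symm ⁻¹' A) := by
  set c := chartAt (EuclideanSpace ℝ (Fin m)) q
  have h : Measurable (c.target.domRestrict c.symm) :=
    (continuousOn_iff_continuous_domRestrict.mp c.continuousOn_symm).measurable
  have h' := c.open_target.measurableSet.subtype_image (h hA)
  convert h' using 1
  ext u
  simp [Set.domRestrict, and_comm]

/-- Change of variables along the transition map, whose Jacobian matches the transformation of `√det
g`. -/
theorem chartVolume_eq_of_subset [IsManifold (𝓡 m) ∞ M] (hx : IsImmersedSubmanifold m x)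
    {q₀ q₁ : M} {A : Set M} (hA : MeasurableSet A)
    (h₀ : A ⊆ (chartAt (EuclideanSpace ℝ (Fin m)) q₀).source)
    (h₁ : A ⊆ (chartAt (EuclideanSpace ℝ (Fin m)) q₁).source) :
    chartVolume m x q₀ A = chartVolume m x q₁ A := by
  have hS : ∀ q, A ⊆ (chartAt (EuclideanSpace ℝ (Fin m)) q).source →
      (chartAt (EuclideanSpace ℝ (Fin m)) q).target ∩
        (chartAt (EuclideanSpace ℝ (Fin m)) q).symm ⁻¹' A =
      chartAt (EuclideanSpace ℝ (Fin m)) q '' A := fun q h => by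
    rw [OpenPartialHomeomorph.image_eq_target_inter_inv_preimage _ h]
  have hmeas := measurableSet_target_inter_symm_preimage (m := m) q₀ hA
  rw [hS q₀ h₀] at hmeas
  rw [chartVolume_apply x q₀ hA, chartVolume_apply x q₁ hA, hS q₀ h₀, hS q₁ h₁]
  have himg : chartAt (EuclideanSpace ℝ (Fin m)) q₁ '' A =
      transition m q₀ q₁ '' (chartAt (EuclideanSpace ℝ (Fin m)) q₀ '' A) := by
    rw [image_image]
    exact image_congr fun r hr => (transition_apply _ (h₀ hr)).symm
  have hinj : InjOn (transition m q₀ q₁) (chartAt (EuclideanSpace ℝ (Fin m)) q₀ '' A) := by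
    rintro _ ⟨r, hr, rfl⟩ _ ⟨s, hs, rfl⟩ h
    rw [transition_apply _ (h₀ hr), transition_apply _ (h₀ hs)] at h
    rw [(chartAt (EuclideanSpace ℝ (Fin m)) q₁).injOn (h₁ hr) (h₁ hs) h]
  rw [himg, lintegral_image_eq_lintegral_abs_det_fderiv_mul volume hmeas
    (f' := fderiv ℝ (transition m q₀ q₁)) ?_ hinj]
  · refine setLIntegral_congr_fun hmeas ?_
    rintro _ ⟨r, hr, rfl⟩
    have hd := (hx.chartSmooth q₁ _ ((chartAt (EuclideanSpace ℝ (Fin m)) q₁).map_source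
      (h₁ hr))).differentiableAt (by simp)
    simp only [metricMatrix_eq]
    rw [sqrt_det_gramAt_inChart (h₀ hr) (h₁ hr) hd, ENNReal.ofReal_mul (abs_nonneg _),
      transition_apply _ (h₀ hr)]
  · rintro _ ⟨r, hr, rfl⟩
    exact ((contDiffAt_transition (h₀ hr) (h₁ hr)).differentiableAt
      (by simp)).hasFDerivAt.hasFDerivWithinAt

theorem chartVolume_inter_source (x : M → EuclideanSpace ℝ (Fin n)) (q : M) {A : Set M}
    (hA : MeasurableSet A) : chartVolume m x q
      (A ∩ (chartAt (EuclideanSpace ℝ (Fin m)) q).source) = chartVolume m x q A := by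
  rw [chartVolume_apply x q hA, chartVolume_apply x q
    (hA.inter (chartAt (EuclideanSpace ℝ (Fin m)) q).open_source.measurableSet)]
  congr 2
  ext u
  simp only [mem_inter_iff, mem_preimage]
  exact ⟨fun h => ⟨h.1, h.2.1⟩, fun h => ⟨h.1, h.2,
    (chartAt (EuclideanSpace ℝ (Fin m)) q).map_target h.1⟩⟩

theorem exists_countable_chart_cover (m : ℕ) (M : Type*) [TopologicalSpace M]
    [ChartedSpace (EuclideanSpace ℝ (Fin m)) M] [SecondCountableTopology M] :
    ∃ s : Set M, s.Countable ∧
      ⋃ q ∈ s, (chartAt (EuclideanSpace ℝ (Fin m)) q).source = univ :=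
  TopologicalSpace.countable_cover_nhds fun q => chart_source_mem_nhds _ q

variable [IsManifold (𝓡 m) ∞ M]

theorem integral_chartVolume (hx : IsImmersedSubmanifold m x) (q : M) {ψ : M → ℝ}
    (hψ : Measurable ψ) :
    ∫ r, ψ r ∂(chartVolume m x q) =
      ∫ u in (chartAt (EuclideanSpace ℝ (Fin m)) q).target,
        √(gramAt (inChart m x q) u).det * inChart m ψ q u := by
  rw [chartVolume, integral_map ((aemeasurable_chart_symm q).mono_ac
    (withDensity_absolutelyContinuous _ _)) hψ.aestronglyMeasurable]
  simp only [metricMatrix_eq]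
  rw [integral_withDensity_eq_integral_toReal_smul₀ (aemeasurable_sqrt_det hx q).ennreal_ofReal
      (by simp)]
  simp only [ENNReal.toReal_ofReal (Real.sqrt_nonneg _), smul_eq_mul]
  rfl


theorem chartVolume_withDensity (hx : IsImmersedSubmanifold m x) (hy : IsImmersedSubmanifold m y)
    (q : M) : chartVolume m y q =
      (chartVolume m x q).withDensity fun r => ENNReal.ofReal (volRatio m x y r) := by
  have hmeas : Measurable fun r => ENNReal.ofReal (volRatio m x y r) :=
    (continuous_volRatio hx hy).measurable.ennreal_ofReal
  ext A hA
  have hS := measurableSet_target_inter_symm_preimage (m := m) q hA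
  set c := chartAt (EuclideanSpace ℝ (Fin m)) q with hc
  have hm := aemeasurable_chart_symm (m := m) q
  rw [withDensity_apply _ hA, ← lintegral_indicator hA]
  have h1 := lintegral_withDensity_eq_lintegral_mul₀ (aemeasurable_sqrt_det hx q).ennreal_ofReal
    ((hmeas.indicator hA).comp_aemeasurable hm)
  simp only [Function.comp_apply] at h1
  conv_rhs => rw [chartVolume]
  simp only [metricMatrix_eq]
  rw [lintegral_map' ((hmeas.indicator hA).aemeasurable)
    (hm.mono_ac (withDensity_absolutelyContinuous _ _)),
    h1, chartVolume_apply y q hA, ← hc,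
    ← lintegral_indicator hS, ← lintegral_indicator c.open_target.measurableSet]
  refine lintegral_congr fun u => ?_
  by_cases hu : u ∈ c.target
  · by_cases huA : c.symm u ∈ A
    · rw [indicator_of_mem (show u ∈ c.target ∩ c.symm ⁻¹' A from ⟨hu, huA⟩), indicator_of_mem hu,
        Pi.mul_apply, Function.comp_apply, indicator_of_mem huA,
        ← ENNReal.ofReal_mul (Real.sqrt_nonneg _),
        volRatio_eq hx hy (c.map_target hu), c.right_inv hu, mul_div_cancel₀]
      · rfl
      · exact (Real.sqrt_pos.mpr (hx.gramAt_det_pos hu)).ne'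
    · rw [indicator_of_notMem (fun h => huA h.2), indicator_of_mem hu,
        Pi.mul_apply, Function.comp_apply, indicator_of_notMem huA, mul_zero]
  · rw [indicator_of_notMem (fun h => hu h.1), indicator_of_notMem hu]

variable [SecondCountableTopology M]

/-- `dV_x` agrees with `√(det g_{ij}) du` on the domain of each chart. -/
theorem inducedVolume_apply_of_subset (hx : IsImmersedSubmanifold m x) {q : M} {A : Set M}
    (hA : MeasurableSet A) (hq : A ⊆ (chartAt (EuclideanSpace ℝ (Fin m)) q).source) :
    inducedVolume m x A = chartVolume m x q A := by
  refine le_antisymm ?_ (Measure.le_iff.mp (le_iSup (chartVolume m x) q) A hA)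
  obtain ⟨s, hs, hcov⟩ := exists_countable_chart_cover m M
  -- The point `q` makes `M` nonempty, hence the cover too, so it can be enumerated by `ℕ`.
  have hne : s.Nonempty := by
    by_contra h
    rw [not_nonempty_iff_eq_empty] at h
    simp only [h, mem_empty_iff_false, iUnion_of_empty, iUnion_empty] at hcov
    exact (hcov.symm ▸ mem_univ q : q ∈ (∅ : Set M))
  obtain ⟨p, rfl⟩ := hs.exists_eq_range hne
  rw [biUnion_range] at hcov
  set U : ℕ → Set M := fun k => (chartAt (EuclideanSpace ℝ (Fin m)) (p k)).source
  have hUm : ∀ k, MeasurableSet (U k) := fun k =>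
    (chartAt (EuclideanSpace ℝ (Fin m)) (p k)).open_source.measurableSet
  have hDm : ∀ k, MeasurableSet (disjointed U k) := fun k => MeasurableSet.disjointed hUm k
  have hDu : ⋃ k, disjointed U k = univ := by rw [iUnion_disjointed, hcov]
  have hsplit : ∀ (μ : Measure M) (C : Set M), MeasurableSet C →
      μ C = ∑' k, μ (C ∩ disjointed U k) := fun μ C hC => by
    rw [← measure_iUnion (fun i j hij => ((disjoint_disjointed U) hij).mono inter_subset_right
      inter_subset_right) (fun k => hC.inter (hDm k)), ← inter_iUnion, hDu, inter_univ]
  -- A competitor for the supremum: cut `M` into disjoint pieces, each inside one chart domain, and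
  -- use that chart's measure on each piece. Agreement on overlaps makes `ν` equal to every chart
  -- measure on its domain, so `ν` is an upper bound for all of them.
  let ν : Measure M := Measure.sum fun k => (chartVolume m x (p k)).restrict (disjointed U k)
  have hν : ∀ (q' : M) (C : Set M), MeasurableSet C →
      C ⊆ (chartAt (EuclideanSpace ℝ (Fin m)) q').source → ν C = chartVolume m x q' C := by
    intro q' C hC hCq
    rw [Measure.sum_apply _ hC, hsplit _ C hC]
    refine tsum_congr fun k => ?_
    rw [Measure.restrict_apply hC]
    exact chartVolume_eq_of_subset hx (hC.inter (hDm k))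
      (inter_subset_right.trans (disjointed_subset U k)) (inter_subset_left.trans hCq)
  have hle : inducedVolume m x ≤ ν := by
    refine iSup_le fun q' => Measure.le_iff.mpr fun C hC => ?_
    rw [← chartVolume_inter_source x q' hC, ← hν q' _ (hC.inter
      (chartAt (EuclideanSpace ℝ (Fin m)) q').open_source.measurableSet) inter_subset_right]
    exact measure_mono inter_subset_left
  exact (Measure.le_iff.mp hle A hA).trans_eq (hν q A hA hq)

theorem inducedVolume_restrict_source (hx : IsImmersedSubmanifold m x) (q : M) :
    (inducedVolume m x).restrict (chartAt (EuclideanSpace ℝ (Fin m)) q).source =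
      chartVolume m x q := by
  ext A hA
  rw [Measure.restrict_apply hA, inducedVolume_apply_of_subset hx (hA.inter
      (chartAt (EuclideanSpace ℝ (Fin m)) q).open_source.measurableSet) inter_subset_right,
    chartVolume_inter_source x q hA]

/-- The density `√det g` is continuous, hence integrable on a closed coordinate ball contained in
the chart target. -/
theorem isLocallyFiniteMeasure_inducedVolume (hx : IsImmersedSubmanifold m x) :
    IsLocallyFiniteMeasure (inducedVolume m x) := by
  refine ⟨fun q => ?_⟩
  set c := chartAt (EuclideanSpace ℝ (Fin m)) q with hc
  obtain ⟨δ, hδ, hball⟩ := Metric.nhds_basis_closedBall.mem_iff.mp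
    (chart_target_mem_nhds (EuclideanSpace ℝ (Fin m)) q)
  set A : Set M := c.source ∩ c ⁻¹' Metric.ball (c q) δ
  have hAo : IsOpen A := c.isOpen_inter_preimage Metric.isOpen_ball
  refine ⟨A, hAo.mem_nhds ⟨mem_chart_source _ q, Metric.mem_ball_self hδ⟩, ?_⟩
  rw [inducedVolume_apply_of_subset hx hAo.measurableSet inter_subset_left,
    chartVolume_apply x q hAo.measurableSet]
  have hsub : c.target ∩ c.symm ⁻¹' A ⊆ Metric.closedBall (c q) δ := by
    rintro u ⟨hu, -, hu'⟩
    rw [mem_preimage, c.right_inv hu] at hu'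
    exact Metric.ball_subset_closedBall hu'
  refine (lintegral_mono_set hsub).trans_lt ?_
  exact (((continuousOn_sqrt_det hx q).mono hball).integrableOn_compact
    (isCompact_closedBall _ _)).lintegral_lt_top

/-- Change of the immersion in the volume measure. -/
theorem inducedVolume_withDensity (hx : IsImmersedSubmanifold m x)
    (hy : IsImmersedSubmanifold m y) : inducedVolume m y =
      (inducedVolume m x).withDensity fun r => ENNReal.ofReal (volRatio m x y r) := by
  obtain ⟨s, hs, hcov⟩ := exists_countable_chart_cover m M
  have := hs.to_subtype
  rw [biUnion_eq_iUnion] at hcov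
  refine Measure.ext_of_iUnion_eq_univ hcov fun q => ?_
  rw [inducedVolume_restrict_source hy, restrict_withDensity
    (chartAt (EuclideanSpace ℝ (Fin m)) q.1).open_source.measurableSet,
    inducedVolume_restrict_source hx, chartVolume_withDensity hx hy]

theorem integral_inducedVolume_change (hx : IsImmersedSubmanifold m x)
    (hy : IsImmersedSubmanifold m y) (ψ : M → ℝ) {D : Set M} (hD : MeasurableSet D) :
    ∫ r in D, ψ r ∂(inducedVolume m y) =
      ∫ r in D, volRatio m x y r * ψ r ∂(inducedVolume m x) := by
  rw [inducedVolume_withDensity hx hy, setIntegral_withDensity_eq_setIntegral_toReal_smul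
    (continuous_volRatio hx hy).measurable.ennreal_ofReal (by simp) _ hD]
  simp only [ENNReal.toReal_ofReal (volRatio_nonneg x y _), smul_eq_mul]

theorem integrableOn_inducedVolume_change (hx : IsImmersedSubmanifold m x)
    (hy : IsImmersedSubmanifold m y) (ψ : M → ℝ) {D : Set M} (hD : MeasurableSet D) :
    IntegrableOn ψ D (inducedVolume m y) ↔
      IntegrableOn (fun r => volRatio m x y r * ψ r) D (inducedVolume m x) := by
  rw [IntegrableOn, inducedVolume_withDensity hx hy, restrict_withDensity hD,
    integrable_withDensity_iff_integrable_smul'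
      (continuous_volRatio hx hy).measurable.ennreal_ofReal (by simp)]
  simp only [ENNReal.toReal_ofReal (volRatio_nonneg x y _), smul_eq_mul]
  rfl

end Volume

/-! ### The divergence theorem -/

theorem integral_fderiv_eq_zero {E : Type*} [NormedAddCommGroup E] [NormedSpace ℝ E]
    [FiniteDimensional ℝ E] [MeasurableSpace E] [BorelSpace E] {μ : Measure E}
    [μ.IsAddHaarMeasure] {Y : E → ℝ} (hY : ContDiff ℝ 1 Y)
    (hc : HasCompactSupport Y) (v : E) : ∫ u, fderiv ℝ Y u v ∂μ = 0 := by
  -- Integration by parts against the constant `1`; only products with `Y` or its derivative have to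
  -- be integrable.
  have h := integral_mul_fderiv_eq_neg_fderiv_mul_of_integrable (μ := μ) (f := fun _ : E => (1 : ℝ))
    (g := Y) (v := v) (by simp) ?_ ?_ (by simp)
    (fun u _ => (hY.differentiable one_ne_zero) u)
  · simpa using h
  · simp only [one_mul]
    exact ((hY.continuous_fderiv one_ne_zero).clm_apply
      continuous_const).integrable_of_hasCompactSupport
      (hc.fderiv_apply ℝ v)
  · simp only [one_mul]
    exact hY.continuous.integrable_of_hasCompactSupport hc

section Divergence

variable {m n : ℕ} {M : Type*} [TopologicalSpace M] [ChartedSpace (EuclideanSpace ℝ (Fin m)) M]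
  {x : M → EuclideanSpace ℝ (Fin n)} {V : M → EuclideanSpace ℝ (Fin n)}

/-- The divergence `g^{ij} ⟨∂V/∂uⁱ, ∂x/∂uʲ⟩` along `x` of a vector field `V`. -/
def divergence (m : ℕ) [ChartedSpace (EuclideanSpace ℝ (Fin m)) M]
    (x V : M → EuclideanSpace ℝ (Fin n)) (r : M) : ℝ :=
  divAt (inChart m x r) (inChart m V r) (chartAt (EuclideanSpace ℝ (Fin m)) r r)

theorem ChartSmooth.smul {W : Type*} [NormedAddCommGroup W] [NormedSpace ℝ W] {φ : M → ℝ}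
    {V : M → W} (hφ : ChartSmooth m φ) (hV : ChartSmooth m V) :
    ChartSmooth m (fun r => φ r • V r) :=
  fun q u hu => (hφ q u hu).smul (hV q u hu)

theorem ChartSmooth.sub {W : Type*} [NormedAddCommGroup W] [NormedSpace ℝ W]
    {V V' : M → W} (hV : ChartSmooth m V) (hV' : ChartSmooth m V') :
    ChartSmooth m (fun r => V r - V' r) :=
  fun q u hu => (hV q u hu).sub (hV' q u hu)

theorem ChartSmooth.differentiableAt {W : Type*} [NormedAddCommGroup W] [NormedSpace ℝ W]
    {φ : M → W} (hφ : ChartSmooth m φ) {q r : M}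
    (hr : r ∈ (chartAt (EuclideanSpace ℝ (Fin m)) q).source) :
    DifferentiableAt ℝ (inChart m φ q) (chartAt (EuclideanSpace ℝ (Fin m)) q r) :=
  (hφ q _ ((chartAt (EuclideanSpace ℝ (Fin m)) q).map_source hr)).differentiableAt (by simp)

theorem divergence_sum {ι : Type*} (s : Finset ι) {V : ι → M → EuclideanSpace ℝ (Fin n)}
    (hV : ∀ a ∈ s, ChartSmooth m (V a)) (r : M) :
    divergence m x (fun r => ∑ a ∈ s, V a r) r = ∑ a ∈ s, divergence m x (V a) r :=
  divAt_sum (V := fun a => inChart m (V a) r) s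
    fun a ha => (hV a ha).differentiableAt (mem_chart_source _ r)

theorem divergence_eq_zero_of_eventually {r : M} (h : ∀ᶠ s in 𝓝 r, V s = 0) :
    divergence m x V r = 0 := by
  have h' : inChart m V r =ᶠ[𝓝 (chartAt (EuclideanSpace ℝ (Fin m)) r r)] fun _ => 0 := by
    refine ((chartAt (EuclideanSpace ℝ (Fin m)) r).continuousAt_symm
      (mem_chart_target _ r)).eventually (p := fun s => V s = 0) ?_
    rwa [(chartAt (EuclideanSpace ℝ (Fin m)) r).left_inv (mem_chart_source _ r)]
  rw [divergence, divAt_congr h']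
  simp [divAt, partialD]

theorem support_divergence_subset : Function.support (divergence m x V) ⊆ tsupport V := by
  intro r hr
  by_contra h
  exact hr (divergence_eq_zero_of_eventually (notMem_tsupport_iff_eventuallyEq.mp h))

variable [IsManifold (𝓡 m) ∞ M]

theorem divergence_eq (hx : IsImmersedSubmanifold m x) (hV : ChartSmooth m V) {q r : M}
    (hr : r ∈ (chartAt (EuclideanSpace ℝ (Fin m)) q).source) :
    divergence m x V r =
      divAt (inChart m x q) (inChart m V q) (chartAt (EuclideanSpace ℝ (Fin m)) q r) :=
  divAt_inChart (mem_chart_source _ r) hr (hx.chartSmooth.differentiableAt hr)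
    (hV.differentiableAt hr)

theorem inChart_divergence (hx : IsImmersedSubmanifold m x) (hV : ChartSmooth m V) {q : M}
    {u : EuclideanSpace ℝ (Fin m)} (hu : u ∈ (chartAt (EuclideanSpace ℝ (Fin m)) q).target) :
    inChart m (divergence m x V) q u = divAt (inChart m x q) (inChart m V q) u := by
  rw [inChart, divergence_eq hx hV ((chartAt (EuclideanSpace ℝ (Fin m)) q).map_target hu),
    (chartAt (EuclideanSpace ℝ (Fin m)) q).right_inv hu]

theorem continuous_divergence (hx : IsImmersedSubmanifold m x) (hV : ChartSmooth m V) :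
    Continuous (divergence m x V) := by
  refine continuous_of_inChart (m := m) fun q => ?_
  have hq := mem_chart_target (EuclideanSpace ℝ (Fin m)) q
  refine (contDiffAt_divAt (hx.chartSmooth q _ hq) (hx.gramAt_det_pos hq)
    (hV q _ hq)).continuousAt.congr ?_
  filter_upwards [(chartAt (EuclideanSpace ℝ (Fin m)) q).open_target.mem_nhds hq] with u hu
  exact (inChart_divergence hx hV hu).symm

/-- The expression of the normal component in a chart. -/
theorem sub_normalPart_eq (hx : IsImmersedSubmanifold m x) {q r : M}
    (hr : r ∈ (chartAt (EuclideanSpace ℝ (Fin m)) q).source) (w : EuclideanSpace ℝ (Fin n)) :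
    w - normalPart m x r w =
      ∑ k, tangCoeff (inChart m x q) (chartAt (EuclideanSpace ℝ (Fin m)) q r) w k •
        partialD (inChart m x q) k (chartAt (EuclideanSpace ℝ (Fin m)) q r) := by
  set u := chartAt (EuclideanSpace ℝ (Fin m)) q r
  have hdet : 0 < (gramAt (inChart m x q) u).det :=
    hx.gramAt_det_pos ((chartAt (EuclideanSpace ℝ (Fin m)) q).map_source hr)
  rw [normalPart, Submodule.starProjection_orthogonal_val, sub_sub_cancel]
  refine (Submodule.eq_starProjection_of_mem_of_inner_eq_zero (K := tangentPlane m x r) ?_ ?_)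
  · rw [tangentPlane_eq hx.smooth hr]
    exact Submodule.sum_mem _ fun k _ => Submodule.smul_mem _ _ ⟨EuclideanSpace.single k 1, rfl⟩
  · rw [tangentPlane_eq hx.smooth hr]
    rintro _ ⟨a, rfl⟩
    rw [ContinuousLinearMap.coe_coe, fderiv_eq_sum_partialD, inner_sum]
    refine Finset.sum_eq_zero fun i _ => ?_
    rw [real_inner_smul_right, inner_sub_left, inner_sum_tangCoeff hdet, sub_self, mul_zero]

/-- The projection is defined pointwise; its smooth dependence on the point is read off from the
coordinate formula with coefficients `tangCoeff`. -/
theorem chartSmooth_sub_normalPart (hx : IsImmersedSubmanifold m x) (hV : ChartSmooth m V) :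
    ChartSmooth m fun r => V r - normalPart m x r (V r) := by
  intro q u hu
  have h := ContDiffAt.sum (s := Finset.univ) fun k _ => (contDiffAt_tangCoeff (hx.chartSmooth q u hu)
    (hx.gramAt_det_pos hu) (hV q u hu) k).smul (contDiffAt_partialD (hx.chartSmooth q u hu) k)
  refine h.congr_of_eventuallyEq ?_
  filter_upwards [(chartAt (EuclideanSpace ℝ (Fin m)) q).open_target.mem_nhds hu] with v hv
  have := sub_normalPart_eq hx ((chartAt (EuclideanSpace ℝ (Fin m)) q).map_target hv)
    (inChart m V q v)
  rw [(chartAt (EuclideanSpace ℝ (Fin m)) q).right_inv hv] at this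
  simpa [inChart] using this

/-- A compactly supported field is a finite sum of fields supported in charts. -/
theorem exists_chart_decomposition [SecondCountableTopology M] [T2Space M]
    (hc : HasCompactSupport V) :
    ∃ (S : Finset M) (f : M → M → ℝ), (∀ i, ChartSmooth m (f i)) ∧
      (∀ i ∈ S, tsupport (f i) ⊆ (chartAt (EuclideanSpace ℝ (Fin m)) i).source) ∧
      ∀ r, V r = ∑ i ∈ S, f i r • V r := by
  have : LocallyCompactSpace M := ChartedSpace.locallyCompactSpace (EuclideanSpace ℝ (Fin m)) M
  obtain ⟨f, hf⟩ := SmoothPartitionOfUnity.exists_isSubordinate_chartAt_source (𝓡 m) M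
  -- Only finitely many functions of the partition meet the compact support of `V`. They sum to one
  -- there, and elsewhere `V` vanishes.
  have hfin := f.locallyFinite.finite_nonempty_inter_compact hc.isCompact
  refine ⟨hfin.toFinset, fun i => f i, fun i => ChartSmooth.of_contMDiff (f i).contMDiff,
    fun i _ => hf i, fun r => ?_⟩
  by_cases hr : r ∈ tsupport V
  · have h1 : ∑ᶠ i, f i r = ∑ i ∈ hfin.toFinset, f i r := by
      refine finsum_eq_sum_of_support_subset _ fun i hi => ?_
      rw [Finite.coe_toFinset]
      exact ⟨r, hi, hr⟩
    rw [← Finset.sum_smul, ← h1, f.sum_eq_one (mem_univ r), one_smul]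
  · simp [image_eq_zero_of_notMem_tsupport hr]

variable [MeasurableSpace M] [BorelSpace M]

/-- The divergence theorem for a field with compact support in the domain of a chart. -/
theorem integral_divergence_chartVolume [T2Space M] (hx : IsImmersedSubmanifold m x)
    (hV : ChartSmooth m V)
    (hc : HasCompactSupport V) (ht : ∀ r, V r ∈ tangentPlane m x r) {q : M}
    (hq : tsupport V ⊆ (chartAt (EuclideanSpace ℝ (Fin m)) q).source) :
    ∫ r, divergence m x V r ∂(chartVolume m x q) = 0 := by
  classical
  set c := chartAt (EuclideanSpace ℝ (Fin m)) q with hcdef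
  set X := inChart m x q
  let a : Fin m → EuclideanSpace ℝ (Fin m) → ℝ := fun k u =>
    √(gramAt X u).det * tangCoeff X u (inChart m V q u) k
  -- Extension by zero of `√(det g) aᵏ` to all of `ℝᵐ`. It is smooth: in the target all ingredients
  -- are, and a point outside the target has a neighbourhood missing the image of `tsupport V`,
  -- which is compact and hence closed.
  let Y : Fin m → EuclideanSpace ℝ (Fin m) → ℝ := fun k => c.target.indicator (a k)
  have hX : ∀ u ∈ c.target, ContDiffAt ℝ ∞ X u := fun u hu => hx.chartSmooth q u hu
  have hdet : ∀ u ∈ c.target, 0 < (gramAt X u).det := fun u hu => hx.gramAt_det_pos hu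
  have hcoef : ∀ k, ∀ u ∈ c.target, ContDiffAt ℝ ∞ (fun v => tangCoeff X v (inChart m V q v) k) u :=
    fun k u hu => contDiffAt_tangCoeff (hX u hu) (hdet u hu) (hV q u hu) k
  have hK : IsCompact (c '' tsupport V) :=
    hc.isCompact.image_of_continuousOn (c.continuousOn.mono hq)
  have hY0 : ∀ k, ∀ u ∉ c '' tsupport V, Y k u = 0 := by
    intro k u hu
    by_cases hut : u ∈ c.target
    · have hV0 : V (c.symm u) = 0 := by
        by_contra h
        exact hu ⟨c.symm u, subset_tsupport V h, c.right_inv hut⟩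
      simp only [Y, a, indicator_of_mem hut]
      simp [tangCoeff, inChart, ← hcdef, hV0]
    · exact indicator_of_notMem hut _
  have hYeq : ∀ k, ∀ u ∈ c.target, Y k =ᶠ[𝓝 u] a k := fun k u hu => by
    filter_upwards [c.open_target.mem_nhds hu] with v hv
    exact indicator_of_mem hv _
  have hYc : ∀ k, HasCompactSupport (Y k) := fun k => HasCompactSupport.intro hK (hY0 k)
  have hYs : ∀ k, ContDiff ℝ 1 (Y k) := fun k => contDiff_iff_contDiffAt.mpr fun u => by
    by_cases hut : u ∈ c.target
    · have h := (((contDiffAt_det (contDiffAt_gramAt (hX u hut))).sqrt (hdet u hut).ne').mul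
        (hcoef k u hut)).congr_of_eventuallyEq (hYeq k u hut)
      exact h.of_le (by exact_mod_cast le_top)
    · have hnot : u ∉ c '' tsupport V := fun ⟨r, hr, h⟩ => hut (h ▸ c.map_source (hq hr))
      refine contDiffAt_const (c := (0 : ℝ)) |>.congr_of_eventuallyEq ?_
      filter_upwards [hK.isClosed.isOpen_compl.mem_nhds hnot] with v hv
      exact hY0 k v hv
  have hpt : ∀ u ∈ c.target, √(gramAt X u).det * inChart m (divergence m x V) q u =
      ∑ k, fderiv ℝ (Y k) u (EuclideanSpace.single k 1) := by
    intro u hu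
    rw [inChart_divergence hx hV hu, mul_comm, divAt_tangent (hX u hu) (hdet u hu)
      (a := fun k v => tangCoeff X v (inChart m V q v) k)
      (fun k => (hcoef k u hu).differentiableAt (by simp))]
    · exact Finset.sum_congr rfl fun k _ => by rw [(hYeq k u hu).fderiv_eq]; rfl
    -- Tangency enters here: `V` is a combination of the `∂ₖX`, and its coefficients must be the
    -- `tangCoeff`.
    · filter_upwards [c.open_target.mem_nhds hu] with v hv
      have h1 := ht (c.symm v)
      rw [tangentPlane_eq hx.smooth (c.map_target hv), ← hcdef, c.right_inv hv] at h1
      obtain ⟨b, hb⟩ := h1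
      rw [ContinuousLinearMap.coe_coe, fderiv_eq_sum_partialD] at hb
      have hb' : inChart m V q v = ∑ i, b i • partialD X i v := hb.symm
      rw [hb']
      exact Finset.sum_congr rfl fun k _ => by rw [tangCoeff_sum (hdet v hv)]
  rw [integral_chartVolume hx q (continuous_divergence hx hV).measurable,
    setIntegral_congr_fun c.open_target.measurableSet hpt,
    setIntegral_eq_integral_of_forall_compl_eq_zero, integral_finsetSum]
  · exact Finset.sum_eq_zero fun k _ => integral_fderiv_eq_zero (hYs k) (hYc k) _
  · exact fun k _ => (((hYs k).continuous_fderiv one_ne_zero).clm_apply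
      continuous_const).integrable_of_hasCompactSupport ((hYc k).fderiv_apply ℝ _)
  · intro u hu
    have hnot : u ∉ c '' tsupport V := fun ⟨r, hr, h⟩ => hu (h ▸ c.map_source (hq hr))
    refine Finset.sum_eq_zero fun k _ => ?_
    have : Y k =ᶠ[𝓝 u] fun _ => 0 := by
      filter_upwards [hK.isClosed.isOpen_compl.mem_nhds hnot] with v hv
      exact hY0 k v hv
    rw [this.fderiv_eq]
    simp

variable [SecondCountableTopology M]

theorem integrable_of_continuous_of_support (hx : IsImmersedSubmanifold m x) {ψ : M → ℝ}
    (hψ : Continuous ψ) {K : Set M} (hK : IsCompact K) [T2Space M]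
    (hsupp : ∀ r ∉ K, ψ r = 0) : Integrable ψ (inducedVolume m x) := by
  have := isLocallyFiniteMeasure_inducedVolume hx
  exact hψ.integrable_of_hasCompactSupport (HasCompactSupport.intro hK hsupp)

theorem integrable_divergence [T2Space M] (hx : IsImmersedSubmanifold m x) (hV : ChartSmooth m V)
    (hc : HasCompactSupport V) : Integrable (divergence m x V) (inducedVolume m x) :=
  integrable_of_continuous_of_support hx (continuous_divergence hx hV) hc.isCompact fun r hr => by
    by_contra h
    exact hr (support_divergence_subset h)

/-- The **divergence theorem** for compactly supported tangent vector fields. -/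
theorem integral_divergence_eq_zero [T2Space M] (hx : IsImmersedSubmanifold m x)
    (hV : ChartSmooth m V) (hc : HasCompactSupport V) (ht : ∀ r, V r ∈ tangentPlane m x r) :
    ∫ r, divergence m x V r ∂(inducedVolume m x) = 0 := by
  obtain ⟨S, f, hf, hsub, hsum⟩ := exists_chart_decomposition (m := m) hc
  have hs : ∀ i, ChartSmooth m fun r => f i r • V r := fun i => (hf i).smul hV
  have hcs : ∀ i, HasCompactSupport fun r => f i r • V r := fun i =>
    HasCompactSupport.intro hc.isCompact fun r hr => by
      rw [image_eq_zero_of_notMem_tsupport hr, smul_zero]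
  have hdiv : divergence m x V = fun r => ∑ i ∈ S, divergence m x (fun r => f i r • V r) r := by
    funext r
    rw [← divergence_sum S fun i _ => hs i]
    exact congrArg (fun V => divergence m x V r) (funext hsum)
  rw [hdiv, integral_finsetSum S fun i _ => integrable_divergence hx (hs i) (hcs i)]
  refine Finset.sum_eq_zero fun i hi => ?_
  have hsub' : tsupport (fun r => f i r • V r) ⊆
      (chartAt (EuclideanSpace ℝ (Fin m)) i).source :=
    (tsupport_smul_subset_left _ _).trans (hsub i hi)
  -- The divergence of `f i • V` lives in the chart domain around `i`, where the volume measure is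
  -- `chartVolume`.
  have h0 : ∀ r ∉ (chartAt (EuclideanSpace ℝ (Fin m)) i).source,
      divergence m x (fun r => f i r • V r) r = 0 := fun r hr => by
    by_contra h
    exact hr (hsub' (support_divergence_subset h))
  rw [← setIntegral_eq_integral_of_forall_compl_eq_zero h0, inducedVolume_restrict_source hx]
  exact integral_divergence_chartVolume hx (hs i) (hcs i)
      (fun r => Submodule.smul_mem _ _ (ht r)) hsub'

end Divergence

/-! ### Gradient identities for the weight -/

section Gradient

variable {m : ℕ} {W' : Type*} [NormedAddCommGroup W'] [InnerProductSpace ℝ W']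
  {X : EuclideanSpace ℝ (Fin m) → W'} {u : EuclideanSpace ℝ (Fin m)}
  {φ ψ : EuclideanSpace ℝ (Fin m) → ℝ}

theorem gradAt_sub (hφ : DifferentiableAt ℝ φ u) (hψ : DifferentiableAt ℝ ψ u) :
    gradAt X (fun v => φ v - ψ v) u = gradAt X φ u - gradAt X ψ u := by
  simp only [gradAt, partialD, fderiv_fun_sub hφ hψ, sub_apply, mul_sub, sub_smul,
    Finset.sum_sub_distrib]

theorem gradAt_exp_neg (hφ : DifferentiableAt ℝ φ u) :
    gradAt X (fun v => Real.exp (-φ v)) u = -(Real.exp (-φ u) • gradAt X φ u) := by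
  have h : ∀ j, partialD (fun v => Real.exp (-φ v)) j u = -(Real.exp (-φ u) * partialD φ j u) := by
    intro j
    rw [partialD, fderiv_exp hφ.fun_neg, fderiv_fun_neg]
    simp [partialD]
  simp only [gradAt, h, Finset.smul_sum, smul_smul, ← Finset.sum_neg_distrib, ← neg_smul]
  exact Finset.sum_congr rfl fun i _ => Finset.sum_congr rfl fun j _ => by congr 1; ring

/-- The right side is the tangential part `X^⊤`; this is what later turns `x` into `x^⊥`. -/
theorem gradAt_half_norm_sq (hX : DifferentiableAt ℝ X u) :
    gradAt X (fun v => 1 / 2 * ‖X v‖ ^ 2) u = ∑ k, tangCoeff X u (X u) k • partialD X k u := by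
  have h : ∀ j, partialD (fun v => 1 / 2 * ‖X v‖ ^ 2) j u = ⟪X u, partialD X j u⟫_ℝ := by
    intro j
    have := (hX.hasFDerivAt.norm_sq.const_mul (1 / 2)).fderiv
    rw [partialD, this]
    simp [partialD]
  simp only [gradAt, h, tangCoeff, Finset.sum_smul]

/-- A gradient is tangent, so it pairs with `w` only through the tangential part of `w`. -/
theorem inner_gradAt_sum_tangCoeff (hdet : 0 < (gramAt X u).det) (w : W') :
    ⟪gradAt X φ u, ∑ k, tangCoeff X u w k • partialD X k u⟫_ℝ = ⟪gradAt X φ u, w⟫_ℝ := by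
  conv_lhs => rw [gradAt]
  conv_rhs => rw [gradAt]
  simp only [sum_inner, real_inner_smul_left]
  refine Finset.sum_congr rfl fun i _ => Finset.sum_congr rfl fun j _ => ?_
  rw [real_inner_comm, inner_sum_tangCoeff hdet, real_inner_comm]

end Gradient

/-! ### The integrand as a divergence minus the density derivative -/

section Pointwise

variable {m n : ℕ} {M : Type*} [TopologicalSpace M] [ChartedSpace (EuclideanSpace ℝ (Fin m)) M]
  {x V : M → EuclideanSpace ℝ (Fin n)}

/-- The weight `|x|² / 2 - ⟨x, ξ⟩ + κ`. -/
def potential (ξ : M → EuclideanSpace ℝ (Fin n)) (κ : M → ℝ) (x : M → EuclideanSpace ℝ (Fin n))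
    (r : M) : ℝ :=
  1 / 2 * ‖x r‖ ^ 2 - (⟪x r, ξ r⟫_ℝ - κ r)

/-- The function `⟨(H + x^⊥ - ξ) + ∇(⟨x, ξ⟩ - κ), v⟩ e^{-φ}`, where `φ = |x|² / 2 - ⟨x, ξ⟩ + κ`. -/
def variationIntegrand (m : ℕ) [ChartedSpace (EuclideanSpace ℝ (Fin m)) M]
    (ξ : M → EuclideanSpace ℝ (Fin n)) (κ : M → ℝ) (x V : M → EuclideanSpace ℝ (Fin n)) (r : M) :
    ℝ :=
  ⟪(meanCurvature m x r + normalPart m x r (x r) - ξ r)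
      + inducedGradient m x (fun s => ⟪x s, ξ s⟫_ℝ - κ s) r, V r⟫_ℝ
    * Real.exp (-potential ξ κ x r)

/-- The time derivative `(div v - ⟨x - ξ, v⟩) e^{-φ}` of the weighted volume density. -/
def densityVariation (m : ℕ) [ChartedSpace (EuclideanSpace ℝ (Fin m)) M]
    (ξ : M → EuclideanSpace ℝ (Fin n)) (κ : M → ℝ) (x V : M → EuclideanSpace ℝ (Fin n)) (r : M) :
    ℝ :=
  (divergence m x V r - ⟪x r - ξ r, V r⟫_ℝ) * Real.exp (-potential ξ κ x r)

/-- The tangent field `e^{-φ} v^⊤`. -/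
def weightedTangent (m : ℕ) [ChartedSpace (EuclideanSpace ℝ (Fin m)) M]
    (ξ : M → EuclideanSpace ℝ (Fin n)) (κ : M → ℝ) (x V : M → EuclideanSpace ℝ (Fin n)) (r : M) :
    EuclideanSpace ℝ (Fin n) :=
  Real.exp (-potential ξ κ x r) • (V r - normalPart m x r (V r))

variable {ξ : M → EuclideanSpace ℝ (Fin n)} {κ : M → ℝ}

theorem chartSmooth_pairing (hx : ChartSmooth m x) (hξ : ChartSmooth m ξ) (hκ : ChartSmooth m κ) :
    ChartSmooth m fun r => ⟪x r, ξ r⟫_ℝ - κ r :=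
  fun q u hu => ((hx q u hu).inner ℝ (hξ q u hu)).sub (hκ q u hu)

theorem chartSmooth_potential (hx : ChartSmooth m x) (hξ : ChartSmooth m ξ)
    (hκ : ChartSmooth m κ) : ChartSmooth m (potential ξ κ x) :=
  fun q u hu => (contDiffAt_const.mul ((hx q u hu).norm_sq ℝ)).sub
    (chartSmooth_pairing hx hξ hκ q u hu)

variable [IsManifold (𝓡 m) ∞ M]

/-- Split `V` into tangential and normal parts. The normal part contributes minus the trace of its
pairing with the second derivatives of `x`, that is `-⟨H, V⟩`. -/
theorem divergence_eq_sub (hx : IsImmersedSubmanifold m x) (hV : ChartSmooth m V) (r : M) :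
    divergence m x V r =
      divergence m x (fun s => V s - normalPart m x s (V s)) r - ⟪meanCurvature m x r, V r⟫_ℝ := by
  set T : M → EuclideanSpace ℝ (Fin n) := fun s => V s - normalPart m x s (V s) with hT
  set N : M → EuclideanSpace ℝ (Fin n) := fun s => normalPart m x s (V s) with hN
  have hTs : ChartSmooth m T := chartSmooth_sub_normalPart hx hV
  have hNs : ChartSmooth m N := by
    have : N = fun s => V s - T s := funext fun s => (sub_sub_cancel _ _).symm
    rw [this]
    exact hV.sub hTs
  have hr := mem_chart_source (EuclideanSpace ℝ (Fin m)) r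
  have hsum : inChart m V r = fun v => inChart m T r v + inChart m N r v :=
    funext fun v => (sub_add_cancel _ _).symm
  have hnormal : divergence m x N r = -⟪meanCurvature m x r, V r⟫_ℝ := by
    rw [divergence, divAt_of_normal (hx.chartSmooth r _ (mem_chart_target _ r))
      (hNs.differentiableAt hr)]
    · simp only [meanCurvature, sum_inner, real_inner_smul_left]
      refine congrArg _ (Finset.sum_congr rfl fun i _ => Finset.sum_congr rfl fun j _ =>
        congrArg _ ?_)
      rw [inChart_chartAt N hr]
      simp only [hN, secondFundamentalForm, normalPart]
      -- Self-adjointness moves the normal projection between `V` and the second derivative of `x`.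
      rw [Submodule.inner_starProjection_left_eq_right]
      rfl
    · filter_upwards [chart_target_mem_nhds (EuclideanSpace ℝ (Fin m)) r] with v hv j
      refine Submodule.inner_left_of_mem_orthogonal (K := tangentPlane m x
        ((chartAt (EuclideanSpace ℝ (Fin m)) r).symm v)) ?_ ?_
      · rw [tangentPlane_eq hx.smooth ((chartAt (EuclideanSpace ℝ (Fin m)) r).map_target hv),
          (chartAt (EuclideanSpace ℝ (Fin m)) r).right_inv hv]
        exact ⟨EuclideanSpace.single j 1, rfl⟩
      · exact Submodule.starProjection_apply_mem _ _
  rw [sub_eq_add_neg, ← hnormal]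
  conv_lhs => rw [divergence, hsum, divAt_add (hTs.differentiableAt hr) (hNs.differentiableAt hr)]
  rfl

/-- The first variation integrand and the time derivative of the density differ by the divergence
of a tangent vector field. -/
theorem variationIntegrand_eq (hx : IsImmersedSubmanifold m x) (hV : ChartSmooth m V)
    (hξ : ChartSmooth m ξ) (hκ : ChartSmooth m κ) (r : M) :
    variationIntegrand m ξ κ x V r =
      divergence m x (weightedTangent m ξ κ x V) r - densityVariation m ξ κ x V r := by
  have hr := mem_chart_source (EuclideanSpace ℝ (Fin m)) r
  have hdet := hx.gramAt_det_pos (mem_chart_target (EuclideanSpace ℝ (Fin m)) r)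
  have hTs := chartSmooth_sub_normalPart hx hV
  have hφ := (chartSmooth_potential hx.chartSmooth hξ hκ).differentiableAt hr
  have hX := hx.chartSmooth.differentiableAt hr
  -- Leibniz rule for `e^{-φ} V^⊤`; the gradient cannot distinguish `V^⊤` from `V`.
  have h1 : divergence m x (weightedTangent m ξ κ x V) r =
      Real.exp (-potential ξ κ x r) *
        divergence m x (fun s => V s - normalPart m x s (V s)) r +
      -(Real.exp (-potential ξ κ x r) * ⟪inducedGradient m x (potential ξ κ x) r, V r⟫_ℝ) := by
    have := divAt_smul (X := inChart m x r) (V := inChart m (fun s => V s - normalPart m x s (V s)) r)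
      (φ := fun v => Real.exp (-inChart m (potential ξ κ x) r v)) hφ.fun_neg.exp
      (hTs.differentiableAt hr)
    rw [gradAt_exp_neg hφ, inChart_chartAt _ hr, inChart_chartAt _ hr, inner_neg_left,
      real_inner_smul_left, sub_normalPart_eq hx hr, inner_gradAt_sum_tangCoeff hdet] at this
    exact this
  have h2 : inducedGradient m x (potential ξ κ x) r = (x r - normalPart m x r (x r)) -
      inducedGradient m x (fun s => ⟪x s, ξ s⟫_ℝ - κ s) r := by
    have h3 := gradAt_sub (X := inChart m x r) ((hX.norm_sq ℝ).const_mul (1 / 2))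
      ((chartSmooth_pairing hx.chartSmooth hξ hκ).differentiableAt hr)
    rw [gradAt_half_norm_sq hX, inChart_chartAt x hr, ← sub_normalPart_eq hx hr] at h3
    exact h3
  -- The terms `div V^⊤` cancel, `x - x^⊤` becomes `x^⊥`, and `-div V` leaves `⟨H, V⟩`.
  rw [h1, h2, variationIntegrand, densityVariation, divergence_eq_sub hx hV]
  simp only [inner_add_left, inner_sub_left]
  ring

variable [MeasurableSpace M] [BorelSpace M] [SecondCountableTopology M] [T2Space M]

theorem integral_divergence_weightedTangent (hx : IsImmersedSubmanifold m x)
    (hV : ChartSmooth m V) (hc : HasCompactSupport V) (hξ : ChartSmooth m ξ)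
    (hκ : ChartSmooth m κ) :
    Integrable (divergence m x (weightedTangent m ξ κ x V)) (inducedVolume m x) ∧
      ∫ r, divergence m x (weightedTangent m ξ κ x V) r ∂(inducedVolume m x) = 0 := by
  have hs : ChartSmooth m (weightedTangent m ξ κ x V) :=
    ChartSmooth.smul (φ := fun r => Real.exp (-potential ξ κ x r))
      (fun q u hu => (chartSmooth_potential hx.chartSmooth hξ hκ q u hu).neg.exp)
      (chartSmooth_sub_normalPart hx hV)
  have hcs : HasCompactSupport (weightedTangent m ξ κ x V) :=
    HasCompactSupport.intro hc.isCompact fun r hr => by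
      simp [weightedTangent, image_eq_zero_of_notMem_tsupport hr, normalPart]
  refine ⟨integrable_divergence hx hs hcs, integral_divergence_eq_zero hx hs hcs fun r => ?_⟩
  refine Submodule.smul_mem _ _ ?_
  rw [normalPart, Submodule.starProjection_orthogonal_val, sub_sub_cancel]
  exact Submodule.starProjection_apply_mem _ _

theorem integrable_densityVariation (hx : IsImmersedSubmanifold m x)
    (hV : ChartSmooth m V) (hc : HasCompactSupport V) (hξ : ChartSmooth m ξ)
    (hκ : ChartSmooth m κ) : Integrable (densityVariation m ξ κ x V) (inducedVolume m x) := by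
  refine integrable_of_continuous_of_support hx ?_ hc.isCompact fun r hr => ?_
  · exact ((continuous_divergence hx hV).sub ((hx.chartSmooth.continuous.sub hξ.continuous).inner
      hV.continuous)).mul
      (chartSmooth_potential hx.chartSmooth hξ hκ).continuous.neg.rexp
  · rw [densityVariation, image_eq_zero_of_notMem_tsupport hr,
      Function.notMem_support.mp fun h => hr (support_divergence_subset h)]
    simp

theorem integral_variationIntegrand (hx : IsImmersedSubmanifold m x)
    (hV : ChartSmooth m V) (hc : HasCompactSupport V) (hξ : ChartSmooth m ξ)
    (hκ : ChartSmooth m κ) :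
    Integrable (variationIntegrand m ξ κ x V) (inducedVolume m x) ∧
      ∫ r, variationIntegrand m ξ κ x V r ∂(inducedVolume m x) =
        -∫ r, densityVariation m ξ κ x V r ∂(inducedVolume m x) := by
  obtain ⟨h1, h2⟩ := integral_divergence_weightedTangent hx hV hc hξ hκ
  have h3 := integrable_densityVariation hx hV hc hξ hκ
  rw [funext (variationIntegrand_eq hx hV hξ hκ)]
  exact ⟨h1.sub h3, by rw [integral_sub h1 h3, h2, zero_sub]⟩

end Pointwise

/-! ### Time-dependent immersions in coordinates -/

section TimeDependent

variable {m : ℕ} {W : Type*} [NormedAddCommGroup W] [NormedSpace ℝ W]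
  {W' : Type*} [NormedAddCommGroup W'] [InnerProductSpace ℝ W']
  {Φ : EuclideanSpace ℝ (Fin m) × ℝ → W} {u : EuclideanSpace ℝ (Fin m)} {t : ℝ}

theorem eventually_differentiableAt (hΦ : ContDiffAt ℝ ∞ Φ (u, t)) :
    ∀ᶠ z in 𝓝 (u, t), DifferentiableAt ℝ Φ z :=
  ((hΦ.of_le (m := 1) (by exact_mod_cast le_top)).eventually (by simp)).mono
    fun _ hz => hz.differentiableAt one_ne_zero

/-- Derivatives of slices are values of the full space-time derivative. Joint smoothness and the
commutation of time and space derivatives are obtained from this. -/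
theorem partialD_slice (hΦ : DifferentiableAt ℝ Φ (u, t)) (i : Fin m) :
    partialD (fun v => Φ (v, t)) i u = fderiv ℝ Φ (u, t) (EuclideanSpace.single i 1, 0) := by
  have h : HasFDerivAt (fun v => Φ (v, t)) _ u :=
    HasFDerivAt.comp u hΦ.hasFDerivAt (hasFDerivAt_prodMk_left u t)
  rw [partialD, h.fderiv]
  simp

theorem deriv_slice (hΦ : DifferentiableAt ℝ Φ (u, t)) :
    HasDerivAt (fun s => Φ (u, s)) (fderiv ℝ Φ (u, t) (0, 1)) t :=
  hΦ.hasFDerivAt.comp_hasDerivAt t ((hasDerivAt_const t u).prodMk (hasDerivAt_id t))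

theorem contDiffAt_partialD_slice (hΦ : ContDiffAt ℝ ∞ Φ (u, t)) (i : Fin m) :
    ContDiffAt ℝ ∞ (fun z : EuclideanSpace ℝ (Fin m) × ℝ => partialD (fun v => Φ (v, z.2)) i z.1)
      (u, t) := by
  refine ((hΦ.fderiv_right (m := ∞) (by simp)).clm_apply
    (contDiffAt_const (c := (EuclideanSpace.single i (1 : ℝ), (0 : ℝ))))).congr_of_eventuallyEq ?_
  filter_upwards [eventually_differentiableAt hΦ] with z hz
  exact partialD_slice hz i

theorem contDiffAt_deriv_slice (hΦ : ContDiffAt ℝ ∞ Φ (u, t)) :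
    ContDiffAt ℝ ∞ (fun z : EuclideanSpace ℝ (Fin m) × ℝ => deriv (fun s => Φ (z.1, s)) z.2)
      (u, t) := by
  refine ((hΦ.fderiv_right (m := ∞) (by simp)).clm_apply
    (contDiffAt_const (c := ((0 : EuclideanSpace ℝ (Fin m)), (1 : ℝ))))).congr_of_eventuallyEq ?_
  filter_upwards [eventually_differentiableAt hΦ] with z hz
  exact (deriv_slice hz).deriv

theorem contDiffAt_slice (hΦ : ContDiffAt ℝ ∞ Φ (u, t)) :
    ContDiffAt ℝ ∞ (fun v => Φ (v, t)) u :=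
  hΦ.comp u (contDiffAt_id.prodMk contDiffAt_const)

/-- The time derivative commutes with the space derivatives. -/
theorem hasDerivAt_partialD_slice (hΦ : ContDiffAt ℝ ∞ Φ (u, t)) (i : Fin m) :
    HasDerivAt (fun s => partialD (fun v => Φ (v, s)) i u)
      (partialD (fun v => deriv (fun s => Φ (v, s)) t) i u) t := by
  have hd : DifferentiableAt ℝ (fderiv ℝ Φ) (u, t) :=
    (hΦ.fderiv_right (m := ∞) (by simp)).differentiableAt (by simp)
  have hev := eventually_differentiableAt hΦ
  have h1 : HasDerivAt (fun s => fderiv ℝ Φ (u, s) (EuclideanSpace.single i 1, 0))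
      (fderiv ℝ (fderiv ℝ Φ) (u, t) (0, 1) (EuclideanSpace.single i 1, 0)) t := by
    simpa using (deriv_slice hd).clm_apply
      (hasDerivAt_const t (EuclideanSpace.single i (1 : ℝ), (0 : ℝ)))
  have h2 : partialD (fun v => deriv (fun s => Φ (v, s)) t) i u =
      fderiv ℝ (fderiv ℝ Φ) (u, t) (EuclideanSpace.single i 1, 0) (0, 1) := by
    have he : (fun v => deriv (fun s => Φ (v, s)) t) =ᶠ[𝓝 u] fun v => fderiv ℝ Φ (v, t) (0, 1) := by
      have hc : Filter.Tendsto (fun v => (v, t)) (𝓝 u) (𝓝 (u, t)) :=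
        (continuous_id.prodMk continuous_const).continuousAt
      filter_upwards [hc.eventually hev] with v hv
      exact (deriv_slice hv).deriv
    rw [partialD_congr he, partialD_slice (Φ := fun z => fderiv ℝ Φ z (0, 1))
      (hd.clm_apply (differentiableAt_const _)), fderiv_clm_apply hd (differentiableAt_const _)]
    simp
  rw [h2, ← (hΦ.isSymmSndFDerivAt
    (by simpa using WithTop.coe_le_coe.mpr (le_top : (2 : ℕ∞) ≤ ⊤))).eq]
  refine h1.congr_of_eventuallyEq ?_
  have hc : Filter.Tendsto (fun s => (u, s)) (𝓝 t) (𝓝 (u, t)) :=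
    (continuous_const.prodMk continuous_id).continuousAt
  filter_upwards [hc.eventually hev] with s hs
  exact partialD_slice hs i

theorem contDiffAt_gramAt_slice {Φ : EuclideanSpace ℝ (Fin m) × ℝ → W'}
    (hΦ : ContDiffAt ℝ ∞ Φ (u, t)) (i j : Fin m) :
    ContDiffAt ℝ ∞ (fun z : EuclideanSpace ℝ (Fin m) × ℝ =>
      gramAt (fun v => Φ (v, z.2)) z.1 i j) (u, t) :=
  (contDiffAt_partialD_slice hΦ i).inner ℝ (contDiffAt_partialD_slice hΦ j)

theorem contDiffAt_divAt_slice {Φ Ψ : EuclideanSpace ℝ (Fin m) × ℝ → W'}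
    (hΦ : ContDiffAt ℝ ∞ Φ (u, t)) (hΨ : ContDiffAt ℝ ∞ Ψ (u, t))
    (hdet : 0 < (gramAt (fun v => Φ (v, t)) u).det) :
    ContDiffAt ℝ ∞ (fun z : EuclideanSpace ℝ (Fin m) × ℝ =>
      divAt (fun v => Φ (v, z.2)) (fun v => Ψ (v, z.2)) z.1) (u, t) :=
  ContDiffAt.sum fun i _ => ContDiffAt.sum fun j _ =>
    (contDiffAt_inv_apply (contDiffAt_gramAt_slice hΦ) hdet.ne' i j).mul
      ((contDiffAt_partialD_slice hΨ i).inner ℝ (contDiffAt_partialD_slice hΦ j))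

/-- The time derivative of the volume density. -/
theorem hasDerivAt_sqrt_det_gramAt {Φ : EuclideanSpace ℝ (Fin m) × ℝ → W'}
    (hΦ : ContDiffAt ℝ ∞ Φ (u, t)) (hdet : 0 < (gramAt (fun v => Φ (v, t)) u).det) :
    HasDerivAt (fun s => √(gramAt (fun v => Φ (v, s)) u).det)
      (√(gramAt (fun v => Φ (v, t)) u).det *
        divAt (fun v => Φ (v, t)) (fun v => deriv (fun s => Φ (v, s)) t) u) t := by
  have h := hasDerivAt_sqrt_det (t := t) (G := fun s => gramAt (fun v => Φ (v, s)) u)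
    (G' := Matrix.of fun i j =>
      ⟪partialD (fun v => deriv (fun s => Φ (v, s)) t) i u, partialD (fun v => Φ (v, t)) j u⟫_ℝ +
      ⟪partialD (fun v => Φ (v, t)) i u, partialD (fun v => deriv (fun s => Φ (v, s)) t) j u⟫_ℝ)
    (fun i j => by
      rw [Matrix.of_apply, add_comm]
      exact (hasDerivAt_partialD_slice hΦ i).inner ℝ (hasDerivAt_partialD_slice hΦ j)) hdet
  rwa [trace_inv_mul_symm (gramAt_inv_symm _ u)] at h

end TimeDependent

/-! ### Differentiation under the integral sign -/

section Variation

variable {m n : ℕ} {M : Type*} [TopologicalSpace M] [ChartedSpace (EuclideanSpace ℝ (Fin m)) M]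
  {x : M → EuclideanSpace ℝ (Fin n)} {ε : ℝ}
  {F : ℝ → M → EuclideanSpace ℝ (Fin n)}
  {ξ : M → EuclideanSpace ℝ (Fin n)} {κ : M → ℝ} {B : Set M}

theorem IsCompactVariation.densityVariation_eq_zero (hB : IsCompactVariation ε F B) {t : ℝ}
    (ht : t ∈ Ioo (-ε) ε) {r : M} (hr : r ∉ B) :
    densityVariation m ξ κ (F t) (velocity F t) r = 0 := by
  have h : r ∉ tsupport (velocity F t) := fun h => hr (hB.support_subset t ht h)
  rw [densityVariation, image_eq_zero_of_notMem_tsupport h,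
    Function.notMem_support.mp fun h' => h (support_divergence_subset h')]
  simp

variable [IsManifold (𝓡 m) ∞ M]

theorem IsVariation.contDiffAt (hF : IsVariation m x ε F) {q : M} {u : EuclideanSpace ℝ (Fin m)}
    (hu : u ∈ (chartAt (EuclideanSpace ℝ (Fin m)) q).target) {t : ℝ} (ht : t ∈ Ioo (-ε) ε) :
    ContDiffAt ℝ ∞ (fun z : EuclideanSpace ℝ (Fin m) × ℝ => inChart m (F z.2) q z.1) (u, t) := by
  have h1 : ContMDiffAt (𝓘(ℝ, EuclideanSpace ℝ (Fin m) × ℝ)) (𝓡 m) ∞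
      (fun z : EuclideanSpace ℝ (Fin m) × ℝ =>
        (chartAt (EuclideanSpace ℝ (Fin m)) q).symm z.1) (u, t) :=
    ((contMDiffOn_chart_symm (I := 𝓡 m) (n := ∞) (x := q)).contMDiffAt
      ((chartAt (EuclideanSpace ℝ (Fin m)) q).open_target.mem_nhds hu)).comp (u, t)
      contDiffAt_fst.contMDiffAt
  have h2 : ContMDiffAt (𝓘(ℝ, EuclideanSpace ℝ (Fin m) × ℝ)) 𝓘(ℝ, ℝ) ∞
      (fun z : EuclideanSpace ℝ (Fin m) × ℝ => z.2) (u, t) := contDiffAt_snd.contMDiffAt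
  have h3 : ContMDiffAt ((𝓡 m).prod 𝓘(ℝ, ℝ)) (𝓡 n) ∞ (fun z : M × ℝ => F z.2 z.1)
      ((chartAt (EuclideanSpace ℝ (Fin m)) q).symm u, t) :=
    hF.smooth.contMDiffAt ((isOpen_univ.prod isOpen_Ioo).mem_nhds ⟨mem_univ _, ht⟩)
  exact contMDiffAt_iff_contDiffAt.mp (h3.comp (u, t) (h1.prodMk h2))

theorem IsVariation.chartSmooth_velocity (hF : IsVariation m x ε F) {t : ℝ}
    (ht : t ∈ Ioo (-ε) ε) : ChartSmooth m (velocity F t) := fun _ _ hu =>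
  contDiffAt_slice (contDiffAt_deriv_slice (hF.contDiffAt hu ht))

theorem IsVariation.hasDerivAt (hF : IsVariation m x ε F) {t : ℝ}
    (ht : t ∈ Ioo (-ε) ε) (r : M) : HasDerivAt (fun s => F s r) (velocity F t r) t := by
  have h := deriv_slice ((hF.contDiffAt (mem_chart_target (EuclideanSpace ℝ (Fin m)) r)
    ht).differentiableAt (by simp))
  simp only [inChart_chartAt _ (mem_chart_source (EuclideanSpace ℝ (Fin m)) r)] at h
  exact h.differentiableAt.hasDerivAt

theorem IsVariation.hasDerivAt_potential (hF : IsVariation m x ε F) {t : ℝ}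
    (ht : t ∈ Ioo (-ε) ε) (r : M) :
    HasDerivAt (fun s => potential ξ κ (F s) r) ⟪F t r - ξ r, velocity F t r⟫_ℝ t := by
  have h := hF.hasDerivAt ht r
  have h' := (h.norm_sq.const_mul (1 / 2)).sub
    ((h.inner ℝ (hasDerivAt_const t (ξ r))).sub_const (κ r))
  convert! h' using 1
  rw [inner_sub_left, inner_zero_right, real_inner_comm (ξ r)]
  ring

/-- The chart and the denominator do not depend on `s`, so this is the logarithmic derivative `div
v` of the volume density. -/
theorem IsVariation.hasDerivAt_volRatio (hF : IsVariation m x ε F) {t s : ℝ}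
    (hs : s ∈ Ioo (-ε) ε) (r : M) :
    HasDerivAt (fun s => volRatio m (F t) (F s) r)
      (volRatio m (F t) (F s) r * divergence m (F s) (velocity F s) r) s := by
  have hr := mem_chart_target (EuclideanSpace ℝ (Fin m)) r
  have h := (hasDerivAt_sqrt_det_gramAt (hF.contDiffAt hr hs)
    ((hF.immersion s hs).gramAt_det_pos hr)).div_const
    √(gramAt (inChart m (F t) r) (chartAt (EuclideanSpace ℝ (Fin m)) r r)).det
  rw [mul_div_right_comm] at h
  exact h

theorem IsVariation.hasDerivAt_density (hF : IsVariation m x ε F) {t s : ℝ}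
    (hs : s ∈ Ioo (-ε) ε) (r : M) :
    HasDerivAt (fun s => volRatio m (F t) (F s) r * Real.exp (-potential ξ κ (F s) r))
      (volRatio m (F t) (F s) r * densityVariation m ξ κ (F s) (velocity F s) r) s := by
  have h := (hF.hasDerivAt_volRatio (t := t) hs r).mul
    (hF.hasDerivAt_potential (ξ := ξ) (κ := κ) hs r).fun_neg.exp
  convert! h using 1
  rw [densityVariation]
  ring

/-- Joint continuity in time and space of the derivative of the weighted density. -/
theorem IsVariation.continuousOn_densityVariation (hF : IsVariation m x ε F)
    (hξ : ChartSmooth m ξ) (hκ : ChartSmooth m κ) {t : ℝ} (ht : t ∈ Ioo (-ε) ε) :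
    ContinuousOn (fun z : ℝ × M =>
      volRatio m (F t) (F z.1) z.2 * densityVariation m ξ κ (F z.1) (velocity F z.1) z.2)
      (Ioo (-ε) ε ×ˢ univ) := by
  rintro ⟨s, q⟩ ⟨hs, -⟩
  refine ContinuousAt.continuousWithinAt ?_
  set c := chartAt (EuclideanSpace ℝ (Fin m)) q with hcdef
  have hq : q ∈ c.source := mem_chart_source _ q
  have hcq : c q ∈ c.target := c.map_source hq
  have hΦ := hF.contDiffAt hcq hs
  have hΨ := contDiffAt_deriv_slice hΦ
  have hdet := (hF.immersion s hs).gramAt_det_pos hcq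
  have hdet' := (hF.immersion t ht).gramAt_det_pos hcq
  -- The function in question, written in the single chart around `q`; the definitions of `volRatio`
  -- and `divergence` use a different chart at each point. Chart invariance makes the two agree near
  -- `(s, q)`.
  let Gz : EuclideanSpace ℝ (Fin m) × ℝ → ℝ := fun z =>
    √(gramAt (inChart m (F z.2) q) z.1).det / √(gramAt (inChart m (F t) q) z.1).det *
    ((divAt (inChart m (F z.2) q) (inChart m (velocity F z.2) q) z.1 -
      ⟪inChart m (F z.2) q z.1 - inChart m ξ q z.1, inChart m (velocity F z.2) q z.1⟫_ℝ) *
      Real.exp (-(1 / 2 * ‖inChart m (F z.2) q z.1‖ ^ 2 -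
        (⟪inChart m (F z.2) q z.1, inChart m ξ q z.1⟫_ℝ - inChart m κ q z.1))))
  have hGc : ContinuousAt Gz (c q, s) := by
    have e1 := ((contDiffAt_det (contDiffAt_gramAt_slice hΦ)).continuousAt).sqrt
    have e2 : ContinuousAt (fun z : EuclideanSpace ℝ (Fin m) × ℝ =>
        √(gramAt (inChart m (F t) q) z.1).det) (c q, s) :=
      ContinuousAt.comp (f := Prod.fst) (x := (c q, s))
        (((continuousOn_sqrt_det (hF.immersion t ht) q).continuousAt
        (c.open_target.mem_nhds hcq))) continuousAt_fst
    have e3 := (contDiffAt_divAt_slice hΦ hΨ hdet).continuousAt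
    have e4 : ContinuousAt (fun z : EuclideanSpace ℝ (Fin m) × ℝ => inChart m ξ q z.1) (c q, s) :=
      ContinuousAt.comp (f := Prod.fst) (x := (c q, s)) (hξ q _ hcq).continuousAt continuousAt_fst
    have e5 : ContinuousAt (fun z : EuclideanSpace ℝ (Fin m) × ℝ => inChart m κ q z.1) (c q, s) :=
      ContinuousAt.comp (f := Prod.fst) (x := (c q, s)) (hκ q _ hcq).continuousAt continuousAt_fst
    have e6 := hΦ.continuousAt
    have e7 := hΨ.continuousAt
    exact (e1.div e2 (Real.sqrt_pos.mpr hdet').ne').mul ((e3.sub ((e6.sub e4).inner e7)).mul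
      ((continuousAt_const.mul (e6.norm.pow 2)).sub ((e6.inner e4).sub e5)).neg.rexp)
  have hmap : ContinuousAt (fun z : ℝ × M => (c z.2, z.1)) (s, q) :=
    (ContinuousAt.comp (f := Prod.snd) (x := (s, q)) (c.continuousAt hq) continuousAt_snd).prodMk
      continuousAt_fst
  refine (ContinuousAt.comp (g := Gz) (f := fun z : ℝ × M => (c z.2, z.1)) (x := (s, q))
    hGc hmap).congr ?_
  filter_upwards [prod_mem_nhds (Ioo_mem_nhds hs.1 hs.2) (c.open_source.mem_nhds hq)]
  rintro ⟨s', r⟩ ⟨hs', hr⟩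
  simp only [Function.comp_apply, Gz]
  rw [volRatio_eq (hF.immersion t ht) (hF.immersion s' hs') hr, densityVariation,
    divergence_eq (hF.immersion s' hs') (hF.chartSmooth_velocity hs') hr, potential,
    inChart_chartAt _ hr, inChart_chartAt _ hr, inChart_chartAt _ hr, inChart_chartAt _ hr]

theorem IsCompactVariation.hasCompactSupport_velocity [T2Space M] (hB : IsCompactVariation ε F B)
    {t : ℝ} (ht : t ∈ Ioo (-ε) ε) : HasCompactSupport (velocity F t) :=
  hB.isCompact_closure.of_isClosed_subset isClosed_closure
    ((hB.support_subset t ht).trans subset_closure)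

theorem continuous_density (hξ : ChartSmooth m ξ) (hκ : ChartSmooth m κ)
    {y : M → EuclideanSpace ℝ (Fin n)}
    (hx : IsImmersedSubmanifold m x) (hy : IsImmersedSubmanifold m y) :
    Continuous fun r => volRatio m x y r * Real.exp (-potential ξ κ y r) :=
  (continuous_volRatio hx hy).mul (chartSmooth_potential hy.chartSmooth hξ hκ).continuous.neg.rexp

theorem volRatio_self (hx : IsImmersedSubmanifold m x) (r : M) : volRatio m x x r = 1 :=
  div_self (Real.sqrt_pos.mpr (hx.gramAt_det_pos (mem_chart_target _ r))).ne'

variable [MeasurableSpace M] [BorelSpace M] [SecondCountableTopology M] [T2Space M] {D : Set M}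

/-- Compare with the measure at time `0`. On the compact closure of `B` the density is continuous.
Off it, the density has zero time derivative on the whole interval, so it equals the initial one,
which is integrable by hypothesis. -/
theorem IsVariation.integrableOn (hε : 0 < ε) (hF : IsVariation m x ε F)
    (hB : IsCompactVariation ε F B) (hξ : ChartSmooth m ξ) (hκ : ChartSmooth m κ)
    (hD : MeasurableSet D)
    (hint : IntegrableOn (fun q => Real.exp (-potential ξ κ x q)) D (inducedVolume m x))
    {t : ℝ} (ht : t ∈ Ioo (-ε) ε) :
    IntegrableOn (fun q => Real.exp (-potential ξ κ (F t) q)) D (inducedVolume m (F t)) := by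
  have h0 : (0 : ℝ) ∈ Ioo (-ε) ε := ⟨neg_lt_zero.mpr hε, hε⟩
  have hx : IsImmersedSubmanifold m x := hF.initial ▸ hF.immersion 0 h0
  rw [integrableOn_inducedVolume_change hx (hF.immersion t ht) _ hD]
  have hC : MeasurableSet (closure B) := isClosed_closure.measurableSet
  have := isLocallyFiniteMeasure_inducedVolume hx
  rw [← inter_union_sdiff D (closure B)]
  refine IntegrableOn.union ?_ ?_
  · exact ((continuous_density hξ hκ hx (hF.immersion t ht)).continuousOn.integrableOn_compact
      hB.isCompact_closure).mono_set inter_subset_right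
  · refine (hint.mono_set sdiff_subset).congr_fun (fun r hr => ?_) (hD.diff hC)
    have hd := fun s (hs : s ∈ Ioo (-ε) ε) => hF.hasDerivAt_density (ξ := ξ) (κ := κ) (t := 0) hs r
    have hconst := isOpen_Ioo.is_const_of_deriv_eq_zero isPreconnected_Ioo
      (fun s hs => (hd s hs).differentiableAt.differentiableWithinAt)
      (fun s hs => by
        rw [(hd s hs).deriv, hB.densityVariation_eq_zero hs fun h => hr.2 (subset_closure h),
          mul_zero]; rfl) h0 ht
    simp only [hF.initial, volRatio_self hx, one_mul] at hconst
    exact hconst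

/-- The first variation formula for a general weight. -/
theorem IsVariation.first_variation (hε : 0 < ε) (hF : IsVariation m x ε F)
    (hB : IsCompactVariation ε F B) (hξ : ChartSmooth m ξ) (hκ : ChartSmooth m κ)
    (hD : MeasurableSet D) (hBD : B ⊆ D)
    (hint : IntegrableOn (fun q => Real.exp (-potential ξ κ x q)) D (inducedVolume m x))
    {t : ℝ} (ht : t ∈ Ioo (-ε) ε) :
    IntegrableOn (fun q => Real.exp (-potential ξ κ (F t) q)) D (inducedVolume m (F t)) ∧
      Integrable (variationIntegrand m ξ κ (F t) (velocity F t)) (inducedVolume m (F t)) ∧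
      HasDerivAt (fun s => ∫ q in D, Real.exp (-potential ξ κ (F s) q) ∂(inducedVolume m (F s)))
        (-∫ q, variationIntegrand m ξ κ (F t) (velocity F t) q ∂(inducedVolume m (F t))) t := by
  have hy := hF.immersion t ht
  have hI := hF.integrableOn hε hB hξ hκ hD hint ht
  obtain ⟨h1, h2⟩ := integral_variationIntegrand hy (hF.chartSmooth_velocity ht)
    (hB.hasCompactSupport_velocity ht) hξ hκ
  refine ⟨hI, h1, ?_⟩
  rw [h2, neg_neg]
  have := isLocallyFiniteMeasure_inducedVolume hy
  have hC : MeasurableSet (closure B) := isClosed_closure.measurableSet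
  obtain ⟨δ, hδ, hball⟩ := Metric.nhds_basis_closedBall.mem_iff.mp (Ioo_mem_nhds ht.1 ht.2)
  have hcont := hF.continuousOn_densityVariation hξ hκ ht
  -- A uniform bound on the derivative for times near `t`. Off `closure B` the derivative is zero,
  -- so `K` times the indicator of `closure B` dominates it, and this is integrable because a
  -- compact set has finite measure.
  obtain ⟨K, hK⟩ := ((isCompact_closedBall t δ).prod hB.isCompact_closure).exists_bound_of_continuousOn
    (hcont.mono (prod_mono hball (subset_univ _)))
  have hmain := (hasDerivAt_integral_of_dominated_loc_of_deriv_le (𝕜 := ℝ) (x₀ := t)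
    (s := Metric.closedBall t δ) (μ := (inducedVolume m (F t)).restrict D)
    (F := fun s r => volRatio m (F t) (F s) r * Real.exp (-potential ξ κ (F s) r))
    (F' := fun s r => volRatio m (F t) (F s) r * densityVariation m ξ κ (F s) (velocity F s) r)
    (bound := (closure B).indicator fun _ => K)
    (Metric.closedBall_mem_nhds t hδ) ?_ ?_ ?_ ?_ ?_ ?_).2
  -- At `s = t` the ratio is `1`, and `B ⊆ D` lets the integral over `D` be taken over all of `M`.
  · have hval : ∫ r in D, volRatio m (F t) (F t) r *
        densityVariation m ξ κ (F t) (velocity F t) r ∂(inducedVolume m (F t)) =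
        ∫ r, densityVariation m ξ κ (F t) (velocity F t) r ∂(inducedVolume m (F t)) := by
      simp only [volRatio_self hy, one_mul]
      exact setIntegral_eq_integral_of_forall_compl_eq_zero fun r hr =>
        hB.densityVariation_eq_zero ht fun h => hr (hBD h)
    rw [hval] at hmain
    refine hmain.congr_of_eventuallyEq ?_
    -- The change of measure needs `F s` to be an immersion, which is known only inside the
    -- interval; near `t` that is enough.
    filter_upwards [Ioo_mem_nhds ht.1 ht.2] with s hs
    exact integral_inducedVolume_change hy (hF.immersion s hs) _ hD
  · filter_upwards [Ioo_mem_nhds ht.1 ht.2] with s hs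
    exact (continuous_density hξ hκ hy (hF.immersion s hs)).aestronglyMeasurable
  · simp only [volRatio_self hy, one_mul]
    exact hI
  · simp only [volRatio_self hy, one_mul]
    exact (integrable_densityVariation hy (hF.chartSmooth_velocity ht)
      (hB.hasCompactSupport_velocity ht) hξ hκ).aestronglyMeasurable.restrict
  · refine ae_of_all _ fun r s hs => ?_
    by_cases hr : r ∈ closure B
    · rw [indicator_of_mem hr]
      exact hK (s, r) ⟨hs, hr⟩
    · rw [indicator_of_notMem hr, hB.densityVariation_eq_zero (hball hs)
        fun h => hr (subset_closure h), mul_zero, norm_zero]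
  · refine Integrable.restrict ?_
    rw [integrable_indicator_iff hC]
    exact integrableOn_const hB.isCompact_closure.measure_ne_top
  · exact ae_of_all _ fun r s hs => hF.hasDerivAt_density (hball hs) r

end Variation

/-! ### The two weights and normal variations -/

section Normal

variable {m n : ℕ} {M : Type*} [TopologicalSpace M] [ChartedSpace (EuclideanSpace ℝ (Fin m)) M]
  {x : M → EuclideanSpace ℝ (Fin n)}

theorem inducedGradient_mem_tangentPlane (hx : ContMDiff (𝓡 m) (𝓡 n) ∞ x) (φ : M → ℝ) (r : M) :
    inducedGradient m x φ r ∈ tangentPlane m x r := by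
  rw [tangentPlane, mfderiv_eq_fderiv_inChart hx]
  exact Submodule.sum_mem _ fun i _ => Submodule.sum_mem _ fun j _ =>
    Submodule.smul_mem _ _ ⟨EuclideanSpace.single i 1, rfl⟩

/-- Expanding the square shows that `κ = |ξ|²/2` is the right choice; subtracting it gives `κ = 0`
for the second weight. -/
theorem weight_eq_potential {M : Type*} (ξ x : M → EuclideanSpace ℝ (Fin n)) :
    weight ξ x = potential ξ (fun r => 1 / 2 * ‖ξ r‖ ^ 2) x := by
  funext r
  rw [weight, potential, norm_sub_sq_real]
  ring

theorem weightBar_eq_potential {M : Type*} (ξ x : M → EuclideanSpace ℝ (Fin n)) :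
    weightBar ξ x = potential ξ (fun _ => 0) x := by
  funext r
  rw [weightBar, weight, potential, norm_sub_sq_real]
  ring

theorem firstVarIntegrand_eq (ξ x V : M → EuclideanSpace ℝ (Fin n)) :
    firstVarIntegrand m ξ x V = variationIntegrand m ξ (fun r => 1 / 2 * ‖ξ r‖ ^ 2) x V := by
  funext r
  rw [firstVarIntegrand, variationIntegrand, weight_eq_potential]

theorem firstVarIntegrandBar_eq (ξ x V : M → EuclideanSpace ℝ (Fin n)) :
    firstVarIntegrandBar m ξ x V = variationIntegrand m ξ (fun _ => 0) x V := by
  funext r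
  simp only [firstVarIntegrandBar, variationIntegrand, weightBar_eq_potential, sub_zero]

/-- The two integrands differ by the pairing of a gradient, which is tangent, with the normal field
`V`. -/
theorem normalVarIntegrand_eq (hx : ContMDiff (𝓡 m) (𝓡 n) ∞ x)
    {ξ V : M → EuclideanSpace ℝ (Fin n)} (hV : ∀ r, V r ∈ (tangentPlane m x r)ᗮ) :
    normalVarIntegrand m ξ x V = firstVarIntegrand m ξ x V := by
  funext r
  rw [normalVarIntegrand, firstVarIntegrand, inner_add_left _ (inducedGradient _ _ _ _),
    Submodule.inner_right_of_mem_orthogonal (inducedGradient_mem_tangentPlane hx _ r) (hV r),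
    add_zero]

theorem normalVarIntegrandBar_eq (hx : ContMDiff (𝓡 m) (𝓡 n) ∞ x)
    {ξ V : M → EuclideanSpace ℝ (Fin n)} (hV : ∀ r, V r ∈ (tangentPlane m x r)ᗮ) :
    normalVarIntegrandBar m ξ x V = firstVarIntegrandBar m ξ x V := by
  funext r
  rw [normalVarIntegrandBar, firstVarIntegrandBar, inner_add_left _ (inducedGradient _ _ _ _),
    Submodule.inner_right_of_mem_orthogonal (inducedGradient_mem_tangentPlane hx _ r) (hV r),
    add_zero]

end Normal

end FirstVariation

end

theorem theorem4p1 {m p : ℕ} {M : Type*} [TopologicalSpace M] [T2Space M]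
    [SecondCountableTopology M] [ChartedSpace (EuclideanSpace ℝ (Fin m)) M]
    [IsManifold (𝓡 m) ∞ M] [MeasurableSpace M] [BorelSpace M]
    (ξ : M → EuclideanSpace ℝ (Fin (m + p))) (hξ : ContMDiff (𝓡 m) (𝓡 (m + p)) ∞ ξ)
    (x : M → EuclideanSpace ℝ (Fin (m + p))) (hx : IsImmersedSubmanifold m x)
    (ε : ℝ) (hε : 0 < ε) (F : ℝ → M → EuclideanSpace ℝ (Fin (m + p)))
    (hF : IsVariation m x ε F) (B : Set M) (hB : IsCompactVariation ε F B)
    (D : Set M) (hD : MeasurableSet D) (hBD : B ⊆ D) :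
    -- the first functional
    (IntegrableOn (fun q => Real.exp (-weight ξ x q)) D (inducedVolume m x) →
      (∀ t ∈ Ioo (-ε) ε,
        IntegrableOn (fun q => Real.exp (-weight ξ (F t) q)) D (inducedVolume m (F t)) ∧
        Integrable (firstVarIntegrand m ξ (F t) (velocity F t))
          (inducedVolume m (F t)) ∧
        HasDerivAt (fun s => volumeXi m ξ (F s) D)
          (-∫ q, firstVarIntegrand m ξ (F t) (velocity F t) q
            ∂(inducedVolume m (F t))) t) ∧
      (IsNormalVariation m x F →
        Integrable (normalVarIntegrand m ξ x (velocity F 0)) (inducedVolume m x) ∧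
        HasDerivAt (fun s => volumeXi m ξ (F s) D)
          (-∫ q, normalVarIntegrand m ξ x (velocity F 0) q
            ∂(inducedVolume m x)) 0)) ∧
    -- the second functional
    (IntegrableOn (fun q => Real.exp (-weightBar ξ x q)) D (inducedVolume m x) →
      (∀ t ∈ Ioo (-ε) ε,
        IntegrableOn (fun q => Real.exp (-weightBar ξ (F t) q)) D
          (inducedVolume m (F t)) ∧
        Integrable (firstVarIntegrandBar m ξ (F t) (velocity F t))
          (inducedVolume m (F t)) ∧
        HasDerivAt (fun s => volumeXiBar m ξ (F s) D)
          (-∫ q, firstVarIntegrandBar m ξ (F t) (velocity F t) q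
            ∂(inducedVolume m (F t))) t) ∧
      (IsNormalVariation m x F →
        Integrable (normalVarIntegrandBar m ξ x (velocity F 0))
          (inducedVolume m x) ∧
        HasDerivAt (fun s => volumeXiBar m ξ (F s) D)
          (-∫ q, normalVarIntegrandBar m ξ x (velocity F 0) q
            ∂(inducedVolume m x)) 0)) := by
  have h0 : (0 : ℝ) ∈ Ioo (-ε) ε := ⟨neg_lt_zero.mpr hε, hε⟩
  have hξs : ChartSmooth m ξ := ChartSmooth.of_contMDiff hξ
  have hκ : ChartSmooth m fun r => 1 / 2 * ‖ξ r‖ ^ 2 := fun q u hu =>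
    contDiffAt_const.mul ((hξs q u hu).norm_sq ℝ)
  have hκ' : ChartSmooth m fun _ : M => (0 : ℝ) := fun _ _ _ => contDiffAt_const
  constructor
  · intro hint
    have main : ∀ t ∈ Ioo (-ε) ε,
        IntegrableOn (fun q => Real.exp (-weight ξ (F t) q)) D (inducedVolume m (F t)) ∧
        Integrable (firstVarIntegrand m ξ (F t) (velocity F t)) (inducedVolume m (F t)) ∧
        HasDerivAt (fun s => volumeXi m ξ (F s) D)
          (-∫ q, firstVarIntegrand m ξ (F t) (velocity F t) q ∂(inducedVolume m (F t))) t := by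
      intro t ht
      simp only [volumeXi, weight_eq_potential, firstVarIntegrand_eq] at hint ⊢
      exact hF.first_variation hε hB hξs hκ hD hBD hint ht
    refine ⟨main, fun hN => ?_⟩
    rw [normalVarIntegrand_eq hx.smooth hN]
    -- The normal case is the general formula at `t = 0`, where `F 0 = x` and the integrands
    -- coincide.
    have h := main 0 h0
    rw [hF.initial] at h
    exact h.2
  · intro hint
    have main : ∀ t ∈ Ioo (-ε) ε,
        IntegrableOn (fun q => Real.exp (-weightBar ξ (F t) q)) D (inducedVolume m (F t)) ∧
        Integrable (firstVarIntegrandBar m ξ (F t) (velocity F t)) (inducedVolume m (F t)) ∧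
        HasDerivAt (fun s => volumeXiBar m ξ (F s) D)
          (-∫ q, firstVarIntegrandBar m ξ (F t) (velocity F t) q ∂(inducedVolume m (F t))) t := by
      intro t ht
      simp only [volumeXiBar, weightBar_eq_potential, firstVarIntegrandBar_eq] at hint ⊢
      exact hF.first_variation hε hB hξs hκ' hD hBD hint ht
    refine ⟨main, fun hN => ?_⟩
    rw [normalVarIntegrandBar_eq hx.smooth hN]
    have h := main 0 h0
    rw [hF.initial] at h
    exact h.2
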